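/- **Setting.** Let $\mathcal X=\prod_{j=1}^d[b_j,c_j]\subset\mathbb R^d$ and let $Q$ be the distribution of a unit $(Y(1),Y(0),X)$ with $X\in\mathcal X$. Assume that $|Y(a)|\le M$ almost surely for some $M<\infty$ and $a\in\{0,1\}$; that each of $Y(1),Y(0)$ has either a continuous distribution or finite support; and that $X=(X_C,X_D)$ (up to the order of the coordinates), where $X_C$ has a bounded density that is strictly positive on the corresponding rectangle and $X_D$ has finite support. **Trees.** A tree partition of depth $0$ of a set $\Gamma\subset\mathcal X$ is the trivial partition; a tree partition of depth $L+1$ is obtained by cutting $\Gamma$ into $\{x\in\Gamma:x_j\le\gamma\}$ and $\{x\in\Gamma:x_j>\gamma\}$ for some $j$ and $\gamma$, and taking a tree partition of depth $L$ of each part (parts may be empty). A stratification tree of depth $L$ is a pair $T=(S,\pi)$ with $S:\mathcal X\to\{1,\dots,2^L\}$ whose strata $S^{-1}(k)$ form a tree partition of depth $L$ of $\mathcal X$, and $\pi=(\pi(k))_{k\le 2^L}$. Trees that have the same nonempty strata with the same targets are identified, also across depths. Put $$V(T)=\sum_{k=1}^{2^L}P(S(X)=k)\left[\big(E[Y(1)-Y(0)\mid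 S(X)=k]-E[Y(1)-Y(0)]\big)^2+\frac{\sigma_0^2(k)}{1-\pi(k)}+\frac{\sigma_1^2(k)}{\pi(k)}\right],$$ where $\sigma_a^2(k)=E[Y(a)^2\mid S(X)=k]-E[Y(a)\mid S(X)=k]^2$ and empty strata contribute $0$. Fix $\nu,\delta>0$ and $\bar L\ge 0$. For $0\le L\le\bar L$ let $\mathcal T_L$ be a countable set of stratification trees of depth $L$ such that every $T=(S,\pi)\in\mathcal T_L$ satisfies $\pi(k)\in[\nu,1-\nu]$ for all $k$, and $P(S(X)=k)>\delta$ whenever $S^{-1}(k)\neq\emptyset$. Assume $\mathcal T_0\subset\mathcal T_1\subset\dots\subset\mathcal T_{\bar L}$ (under the above identification). Let $V^*_L=\inf_{T\in\mathcal T_L}V(T)$. **Pilot data.** The units $(Y_j(1),Y_j(0),X_j)$, $j\ge1$, are i.i.d. draws from $Q$, and treatments are assigned by simple random assignment: the $A_j\in\{0,1\}$ are i.i.d. coin flips with $P(A_j=1)=q$ for some $q\in(0,1)$, independent of the units. One observes $W_j=(Y_j,A_j,X_j)$ with $Y_j=Y_j(1)A_j+Y_j(0)(1-A_j)$. **Empirical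 minimizers.** For a sample of size $n$ define $$\widetilde V(T)=\sum_{k}\frac{m(k)}{n}\left[\big(\hat E[Y(1)-Y(0)\mid S(X)=k]-\hat E[Y(1)-Y(0)]\big)^2+\frac{\hat\sigma_0^2(k)}{1-\pi(k)}+\frac{\hat\sigma_1^2(k)}{\pi(k)}\right],$$ where $m(k)$ is the number of sample points in stratum $k$, $\hat E[f(Y(a))\mid S(X)=k]$ is the average of $f(Y_j)$ over the sample points with $A_j=a$ and $S(X_j)=k$, $\hat E[Y(1)-Y(0)]$ is the difference of the overall averages of $Y_j$ among the treated and among the untreated, and $\hat\sigma_a^2(k)=\hat E[Y(a)^2\mid S(X)=k]-\hat E[Y(a)\mid S(X)=k]^2$; set $\widetilde V(T)=\infty$ if some nonempty set $S^{-1}(k)$ contains no treated or no untreated sample point. For each $L\le\bar L$ and each sample size, let $\hat T_L$ be a $\mathcal T_L$-valued function of the sample such that, almost surely, $\hat T_L$ minimizes $\widetilde V$ over $\mathcal T_L$. **Cross-validation.** For an even sample size $m$, let $\hat T_L,\hat T_L^{(1)},\hat T_L^{(2)}$ be the trees estimated in this way on the whole pilot sample $W_1,\dots,W_m$, on its first half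 and on its second half, and let $\widetilde V^{(1)},\widetilde V^{(2)}$ be the empirical variances computed on the two halves. Let $$\widetilde V^{CV}_L=\tfrac12\left(\widetilde V^{(1)}(\hat T^{(2)}_L)+\widetilde V^{(2)}(\hat T^{(1)}_L)\right),$$ let $\hat L$ be the smallest minimizer of $\widetilde V^{CV}_L$ over $0\le L\le\bar L$, and let $\hat T^{CV}=\hat T_{\hat L}$. **Proposition.** If the estimators $\hat T_L$ are measurable functions of the sample (all subsets of the countable sets $\mathcal T_L$ being measurable), then so is $\hat T^{CV}$. Moreover, with or without this measurability, $$\big|V(\hat T^{CV})-V^*_{\bar L}\big|\longrightarrow 0\quad\text{almost surely as } m\to\infty .$$ -/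

import Mathlib

open MeasureTheory ProbabilityTheory Filter Topology

noncomputable section

namespace StratTrees

/-- The covariate space `𝒳 = ∏ j, [b j, c j]`, a rectangle in `ℝ^d`. -/
abbrev CovSpace {d : ℕ} (b c : Fin d → ℝ) : Type := ↥(Set.Icc b c)

/-- A unit `(Y(1), Y(0), X)`: both potential outcomes and the covariates. -/
abbrev PotUnit {d : ℕ} (b c : Fin d → ℝ) : Type := ℝ × ℝ × CovSpace b c

/-- An observed data point `W = (Y, A, X)`; `A = true` means treatment `1`. -/
abbrev Obs {d : ℕ} (b c : Fin d → ℝ) : Type := ℝ × Bool × CovSpace b c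

variable {d : ℕ} {b c : Fin d → ℝ}

/-- The potential outcome `Y(a)` of a unit. -/
def pot (a : Bool) (z : PotUnit b c) : ℝ := if a = true then z.1 else z.2.1

/-- The observed data point of the unit `z` when its treatment is `a`:
`Y = Y(1) A + Y(0) (1 - A)`. -/
def observe (z : PotUnit b c) (a : Bool) : Obs b c := (pot a z, a, z.2.2)

/-! ### Tree partitions and stratification trees -/

/-- The nonempty sets among the fibres `Γ ∩ S⁻¹(k)` form a tree partition of depth `L` on `Γ`.
Depth `0` is the trivial partition; a tree partition of depth `L + 1` cuts `Γ` into
`Γ_D = {x ∈ Γ : x_j ≤ γ}` and `Γ_U = {x ∈ Γ : x_j > γ}` and takes a tree partition of depth `L` on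
each part, the labels used on `Γ_D` being different from those used on `Γ_U`.  Either part may be
empty; a threshold `γ` outside the range of the `j`-th coordinate on `Γ` gives no
other partition than the trivial cut into `Γ` and the empty set. -/
def FormsTreePartition {ι : Type} (S : CovSpace b c → ι) : ℕ → Set (CovSpace b c) → Prop
  | 0, Γ => ∃ k, ∀ x ∈ Γ, S x = k
  | L + 1, Γ => ∃ (j : Fin d) (γ : ℝ),
      FormsTreePartition S L {x ∈ Γ | x.1 j ≤ γ} ∧
      FormsTreePartition S L {x ∈ Γ | γ < x.1 j} ∧
      ∀ x ∈ Γ, ∀ y ∈ Γ, x.1 j ≤ γ → γ < y.1 j → S x ≠ S y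

variable (b c) in
/-- A stratification tree `T = (S, π)` of depth `L` on `𝒳`: a map `S : 𝒳 → [2^L]` whose strata form
a tree partition of depth `L`, and a target proportion `π k` for each stratum. -/
structure StratTree (L : ℕ) where
  S : CovSpace b c → Fin (2 ^ L)
  π : Fin (2 ^ L) → ℝ
  isTree : FormsTreePartition S L Set.univ

/-- Two stratification trees, possibly of different nominal depths, are the same up to the labels of
the strata and up to empty strata: they have the same nonempty strata, with the same targets. -/
def SameTree {L L' : ℕ} (T : StratTree b c L) (T' : StratTree b c L') : Prop :=
  (∀ x y, T.S x = T.S y ↔ T'.S x = T'.S y) ∧ ∀ x, T.π (T.S x) = T'.π (T'.S x)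

/-- The restriction on cell sizes and targets: `π(k) ∈ [ν, 1 - ν]`, and
`P(S(X) = k) > δ` whenever `S⁻¹(k)` is nonempty. -/
def Admissible (Q : Measure (PotUnit b c)) (ν δ : ℝ) {L : ℕ} (T : StratTree b c L) : Prop :=
  (∀ k, T.π k ∈ Set.Icc ν (1 - ν)) ∧
  ∀ k, (∃ x, T.S x = k) → δ < Q.real {z | T.S z.2.2 = k}

/-! ### Assumptions on the distribution of the units -/

/-- A real random variable is continuous (its law has no atoms) or discrete with finite support. -/
def ContinuousOrFinite {α : Type} [MeasurableSpace α] (Q : Measure α) (f : α → ℝ) : Prop :=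
  (∀ y, Q {z | f z = y} = 0) ∨ ∃ F : Finset ℝ, ∀ᵐ z ∂Q, f z ∈ F

/-- Bounded potential outcomes, each continuous or finitely supported; the
covariates in `C` have jointly a bounded density that is strictly positive on their rectangle, and
the others have finite support. (That `X` takes values in the rectangle `𝒳` is part of the type.) -/
structure RegularDesign (Q : Measure (PotUnit b c)) : Prop where
  bounded : ∃ M : ℝ, ∀ᵐ z ∂Q, ∀ a, pot a z ∈ Set.Icc (-M) M
  outcome : ∀ a, ContinuousOrFinite Q (pot a)
  covariates : ∃ C : Finset (Fin d),
    (∃ f : (C → ℝ) → ℝ, Measurable f ∧ (∃ B : ℝ, ∀ x, f x ≤ B) ∧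
      (∀ x ∈ Set.Icc (fun j : C => b j) (fun j : C => c j), 0 < f x) ∧
      Q.map (fun z (j : C) => z.2.2.1 j) =
        (volume.restrict (Set.Icc (fun j : C => b j) (fun j : C => c j))).withDensity
          (fun x => ENNReal.ofReal (f x))) ∧
    ∃ F : Finset (Fin d → ℝ), ∀ᵐ z ∂Q, ∃ y ∈ F, ∀ j ∉ C, z.2.2.1 j = y j

/-! ### The population variance -/

/-- `E[f | S(X) = k]`; it is `0` when the stratum is empty. -/
def cellMean (Q : Measure (PotUnit b c)) {L : ℕ} (T : StratTree b c L) (k : Fin (2 ^ L))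
    (f : PotUnit b c → ℝ) : ℝ :=
  ∫ z, f z ∂(ProbabilityTheory.cond Q {z | T.S z.2.2 = k})

/-- `σ_a²(k) = E[Y(a)² | S(X) = k] - E[Y(a) | S(X) = k]²`. -/
def cellVar (Q : Measure (PotUnit b c)) {L : ℕ} (T : StratTree b c L) (a : Bool)
    (k : Fin (2 ^ L)) : ℝ :=
  cellMean Q T k (fun z => pot a z ^ 2) - cellMean Q T k (pot a) ^ 2

/-- The asymptotic variance `V(T)`. -/
def V (Q : Measure (PotUnit b c)) {L : ℕ} (T : StratTree b c L) : ℝ :=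
  ∑ k, Q.real {z | T.S z.2.2 = k} *
    ((cellMean Q T k (fun z => pot true z - pot false z)
        - ∫ z, (pot true z - pot false z) ∂Q) ^ 2
      + (cellVar Q T false k / (1 - T.π k) + cellVar Q T true k / T.π k))

/-- `V*`, the infimum of `V` over a class of stratification trees. -/
def Vstar (Q : Measure (PotUnit b c)) {L : ℕ} (𝒯 : Set (StratTree b c L)) : ℝ :=
  sInf (V Q '' 𝒯)

/-! ### The empirical variance -/

/-- `m(k; T)`, the number of data points in stratum `k`. -/
def countCell {n : ℕ} (w : Fin n → Obs b c) {L : ℕ} (T : StratTree b c L) (k : Fin (2 ^ L)) : ℕ :=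
  (Finset.univ.filter fun j => T.S (w j).2.2 = k).card

/-- `m_a(k; T)`, the number of data points with treatment `a` in stratum `k`. -/
def countArm {n : ℕ} (w : Fin n → Obs b c) {L : ℕ} (T : StratTree b c L) (a : Bool)
    (k : Fin (2 ^ L)) : ℕ :=
  (Finset.univ.filter fun j => (w j).2.1 = a ∧ T.S (w j).2.2 = k).card

/-- `Ê[f(Y(a)) | S(X) = k]`, the average of `f(Y_j)` over the data points with treatment `a` in
stratum `k`. -/
def empCellMean {n : ℕ} (w : Fin n → Obs b c) {L : ℕ} (T : StratTree b c L) (a : Bool)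
    (k : Fin (2 ^ L)) (f : ℝ → ℝ) : ℝ :=
  (∑ j with (w j).2.1 = a ∧ T.S (w j).2.2 = k, f (w j).1) / (countArm w T a k : ℝ)

/-- `Ê[Y(a)]`, the average outcome over all the data points with treatment `a`. -/
def empMean {n : ℕ} (w : Fin n → Obs b c) (a : Bool) : ℝ :=
  (∑ j with (w j).2.1 = a, (w j).1) / ((Finset.univ.filter fun j => (w j).2.1 = a).card : ℝ)

/-- `σ̂_a²(k) = Ê[Y(a)² | S(X) = k] - Ê[Y(a) | S(X) = k]²`. -/
def empCellVar {n : ℕ} (w : Fin n → Obs b c) {L : ℕ} (T : StratTree b c L) (a : Bool)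
    (k : Fin (2 ^ L)) : ℝ :=
  empCellMean w T a k (fun y => y ^ 2) - empCellMean w T a k (fun y => y) ^ 2

open Classical in
/-- The empirical variance `Ṽ(T)` computed on the data `w`.  It is `∞` when some cell of the tree
partition contains no treated or no untreated data point. -/
def empVar {n : ℕ} (w : Fin n → Obs b c) {L : ℕ} (T : StratTree b c L) : EReal :=
  if ∀ k, (∃ x, T.S x = k) → ∀ a, 0 < countArm w T a k then
    ((∑ k, (countCell w T k : ℝ) / (n : ℝ) *
      ((empCellMean w T true k (fun y => y) - empCellMean w T false k (fun y => y)
          - (empMean w true - empMean w false)) ^ 2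
        + (empCellVar w T false k / (1 - T.π k) + empCellVar w T true k / T.π k)) : ℝ) : EReal)
  else ⊤

/-! ### Empirical minimization and two-fold cross-validation -/

/-- An estimation rule: for each depth `L` and each sample size `n`, a stratification tree of depth
`L` as a function of the data. -/
abbrev TreeRule {d : ℕ} (b c : Fin d → ℝ) : Type :=
  (L n : ℕ) → (Fin n → Obs b c) → StratTree b c L

/-- The first half `𝒟₁` of a sample of size `n + n`. -/
def fold1 {n : ℕ} (w : Fin (n + n) → Obs b c) : Fin n → Obs b c := fun j => w (Fin.castAdd n j)

/-- The second half `𝒟₂` of a sample of size `n + n`. -/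
def fold2 {n : ℕ} (w : Fin (n + n) → Obs b c) : Fin n → Obs b c := fun j => w (Fin.natAdd n j)

/-- The criterion `½ (Ṽ⁽¹⁾(T̂_L⁽²⁾) + Ṽ⁽²⁾(T̂_L⁽¹⁾))`. -/
def cvCriterion (est : TreeRule b c) {n : ℕ} (w : Fin (n + n) → Obs b c) (L : ℕ) : EReal :=
  (empVar (fold1 w) (est L n (fold2 w)) + empVar (fold2 w) (est L n (fold1 w))) / 2

/-- `L̂`: the smallest minimizer of the cross-validation criterion over `0 ≤ L ≤ Lbar`. -/
def cvDepth (est : TreeRule b c) (Lbar : ℕ) {n : ℕ} (w : Fin (n + n) → Obs b c) : ℕ :=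
  sInf {L | L ≤ Lbar ∧ ∀ L' ≤ Lbar, cvCriterion est w L ≤ cvCriterion est w L'}

/-- The cross-validated tree: the tree of depth `L̂` estimated on the full sample, together with
its depth. -/
def cvTree (est : TreeRule b c) (Lbar : ℕ) {n : ℕ} (w : Fin (n + n) → Obs b c) :
    Σ L, StratTree b c L :=
  ⟨cvDepth est Lbar w, est (cvDepth est Lbar w) (n + n) w⟩

/-! ### The pilot experiment -/

/-- The units are i.i.d. draws `Z j = (Y_j(1), Y_j(0), X_j)` from `Q`, and every unit is assigned to
treatment `1` by an independent coin flip with weight `q`. -/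
structure SimpleRandomAssignment {Ω : Type*} [MeasurableSpace Ω] (P : Measure Ω)
    (Q : Measure (PotUnit b c)) (q : ℝ) (Z : ℕ → Ω → PotUnit b c) (A : ℕ → Ω → Bool) : Prop where
  measurable_unit : ∀ j, Measurable (Z j)
  measurable_assignment : ∀ j, Measurable (A j)
  law_unit : ∀ j, P.map (Z j) = Q
  prob_treated : ∀ j, P {ω | A j ω = true} = ENNReal.ofReal q
  indep_unit_assignment : ∀ j, IndepFun (Z j) (A j) P
  indep_across : iIndepFun (fun j ω => (Z j ω, A j ω)) P

/-- The pilot sample `W_1, …, W_n`. -/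
def pilot {Ω : Type*} (Z : ℕ → Ω → PotUnit b c) (A : ℕ → Ω → Bool) (n : ℕ) (ω : Ω) :
    Fin n → Obs b c :=
  fun j => observe (Z j ω) (A j ω)

end StratTrees

end

/-! The heart is a uniform strong law. Every stratum of a depth-`L` tree is an intersection of `L +
1` half-spaces (counting the empty set and the whole space). For any law of the covariates such sets
have finite bracketing: the sublevel sets of a coordinate are bracketed by compactness of its range,
and complements, finite unions of classes and intersections preserve the property. The strong law on
the finitely many brackets then gives, almost surely, convergence of the empirical moments n⁻¹ ∑ Y^r
1{A = a, X ∈ C} to P(A = a) E[Y(a)^r 1{X ∈ C}], uniformly over cells C (`ae_uniform_empMoment`).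

Both variances are sums over strata of one function, `cellTerm`, of ratios of such moments. On
nonempty strata the denominators stay away from 0 because of δ and ν, and empty strata contribute
nothing. Hence Ṽ - V tends to 0 along every sequence of admissible trees, however the trees depend
on the data (`empVar_sub_V`). Uniformity is used throughout in this sequential form.

Two consequences finish the convergence. Empirical minimizers satisfy V(T̂_L) → V*_L, on the full
sample and on each half. The criterion for depth L evaluates on one half a tree fitted on the other,
so it also tends to V*_L. Since nesting makes V*_Lbar the smallest of these finitely many limits,
the chosen depth is eventually near-optimal, and so is the tree of that depth refitted on the full
sample.

Measurability rests on countability: a tree-valued estimator splits the sample space into countably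
many measurable pieces, on each of which the tree is fixed and Ṽ is a measurable function of the
data. -/

noncomputable section

namespace StratTrees

/-! ### Finite bracketing and a uniform law of large numbers -/

/-- A class of sets has finite bracketing if, for every `ε > 0`, finitely many pairs `A ⊆ B` of
measurable sets with `ρ (B \ A) < ε` enclose all the sets of the class. -/
def HasFiniteBracketing {α : Type*} [MeasurableSpace α] (ρ : Measure α) (𝒞 : Set (Set α)) : Prop :=
  ∀ ε : ℝ, 0 < ε → ∃ F : Set (Set α × Set α), F.Finite ∧
    (∀ p ∈ F, MeasurableSet p.1 ∧ MeasurableSet p.2 ∧ ρ.real (p.2 \ p.1) < ε) ∧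
    ∀ C ∈ 𝒞, ∃ p ∈ F, p.1 ⊆ C ∧ C ⊆ p.2

namespace HasFiniteBracketing

variable {α β : Type*} [MeasurableSpace α] [MeasurableSpace β]

theorem singleton (ρ : Measure α) {C : Set α} (hC : MeasurableSet C) :
    HasFiniteBracketing ρ {C} := by
  intro ε hε
  refine ⟨{(C, C)}, Set.finite_singleton _, ?_, ?_⟩
  · rintro p rfl
    simpa using ⟨hC, hε⟩
  · rintro D rfl
    exact ⟨_, rfl, subset_rfl, subset_rfl⟩

theorem union {ρ : Measure α} {𝒞 𝒟 : Set (Set α)} (h : HasFiniteBracketing ρ 𝒞)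
    (h' : HasFiniteBracketing ρ 𝒟) : HasFiniteBracketing ρ (𝒞 ∪ 𝒟) := by
  intro ε hε
  obtain ⟨F, hF, hF1, hF2⟩ := h ε hε
  obtain ⟨G, hG, hG1, hG2⟩ := h' ε hε
  refine ⟨F ∪ G, hF.union hG, ?_, ?_⟩
  · rintro p (hp | hp)
    exacts [hF1 p hp, hG1 p hp]
  · rintro C (hC | hC)
    · obtain ⟨p, hp, h⟩ := hF2 C hC
      exact ⟨p, Or.inl hp, h⟩
    · obtain ⟨p, hp, h⟩ := hG2 C hC
      exact ⟨p, Or.inr hp, h⟩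

theorem iUnion {ι : Type*} [Finite ι] {ρ : Measure α} {𝒞 : ι → Set (Set α)}
    (h : ∀ i, HasFiniteBracketing ρ (𝒞 i)) : HasFiniteBracketing ρ (⋃ i, 𝒞 i) := by
  intro ε hε
  choose F hF hF1 hF2 using fun i => h i ε hε
  refine ⟨⋃ i, F i, Set.finite_iUnion hF, ?_, ?_⟩
  · intro p hp
    obtain ⟨i, hi⟩ := Set.mem_iUnion.1 hp
    exact hF1 i p hi
  · intro C hC
    obtain ⟨i, hi⟩ := Set.mem_iUnion.1 hC
    obtain ⟨p, hp, h⟩ := hF2 i C hi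
    exact ⟨p, Set.mem_iUnion.2 ⟨i, hp⟩, h⟩

theorem compl {ρ : Measure α} {𝒞 : Set (Set α)} (h : HasFiniteBracketing ρ 𝒞) :
    HasFiniteBracketing ρ (Compl.compl '' 𝒞) := by
  intro ε hε
  obtain ⟨F, hF, hF1, hF2⟩ := h ε hε
  refine ⟨(fun p => (p.2ᶜ, p.1ᶜ)) '' F, hF.image _, ?_, ?_⟩
  · rintro _ ⟨p, hp, rfl⟩
    obtain ⟨h1, h2, h3⟩ := hF1 p hp
    refine ⟨h2.compl, h1.compl, ?_⟩
    rwa [show p.1ᶜ \ p.2ᶜ = p.2 \ p.1 by ext; simp; tauto]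
  · rintro _ ⟨C, hC, rfl⟩
    obtain ⟨p, hp, h1, h2⟩ := hF2 C hC
    exact ⟨_, ⟨p, hp, rfl⟩, Set.compl_subset_compl.2 h2, Set.compl_subset_compl.2 h1⟩

/-- Intersecting brackets gives brackets: the new gap lies in the union of the two old gaps, so half
of ε for each suffices. -/
theorem inter {ρ : Measure α} [IsFiniteMeasure ρ] {𝒞 𝒟 : Set (Set α)}
    (h : HasFiniteBracketing ρ 𝒞) (h' : HasFiniteBracketing ρ 𝒟) :
    HasFiniteBracketing ρ (Set.image2 (· ∩ ·) 𝒞 𝒟) := by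
  intro ε hε
  obtain ⟨F, hF, hF1, hF2⟩ := h (ε / 2) (by positivity)
  obtain ⟨G, hG, hG1, hG2⟩ := h' (ε / 2) (by positivity)
  refine ⟨Set.image2 (fun p p' => (p.1 ∩ p'.1, p.2 ∩ p'.2)) F G, hF.image2 _ hG, ?_, ?_⟩
  · rintro _ ⟨p, hp, p', hp', rfl⟩
    obtain ⟨h1, h2, h3⟩ := hF1 p hp
    obtain ⟨h1', h2', h3'⟩ := hG1 p' hp'
    refine ⟨h1.inter h1', h2.inter h2', ?_⟩
    calc ρ.real ((p.2 ∩ p'.2) \ (p.1 ∩ p'.1))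
        ≤ ρ.real ((p.2 \ p.1) ∪ (p'.2 \ p'.1)) := by
          refine measureReal_mono ?_
          intro x; simp; tauto
      _ ≤ ρ.real (p.2 \ p.1) + ρ.real (p'.2 \ p'.1) := measureReal_union_le _ _
      _ < ε := by linarith
  · rintro _ ⟨C, hC, D, hD, rfl⟩
    obtain ⟨p, hp, h1, h2⟩ := hF2 C hC
    obtain ⟨p', hp', h1', h2'⟩ := hG2 D hD
    exact ⟨_, ⟨p, hp, p', hp', rfl⟩, Set.inter_subset_inter h1 h1', Set.inter_subset_inter h2 h2'⟩

theorem preimage {ρ : Measure β} {f : β → α} (hf : Measurable f) {𝒞 : Set (Set α)}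
    (h : HasFiniteBracketing (ρ.map f) 𝒞) :
    HasFiniteBracketing ρ ((fun C => f ⁻¹' C) '' 𝒞) := by
  intro ε hε
  obtain ⟨F, hF, hF1, hF2⟩ := h ε hε
  refine ⟨(fun p => (f ⁻¹' p.1, f ⁻¹' p.2)) '' F, hF.image _, ?_, ?_⟩
  · rintro _ ⟨p, hp, rfl⟩
    obtain ⟨h1, h2, h3⟩ := hF1 p hp
    refine ⟨hf h1, hf h2, ?_⟩
    rwa [map_measureReal_apply hf (h2.diff h1)] at h3
  · rintro _ ⟨C, hC, rfl⟩
    obtain ⟨p, hp, h1, h2⟩ := hF2 C hC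
    exact ⟨_, ⟨p, hp, rfl⟩, Set.preimage_mono h1, Set.preimage_mono h2⟩

/-- Every point of the line has a neighbourhood that is small apart from the point itself. -/
theorem exists_Ioo_diff_singleton_lt (ρ : Measure ℝ) [IsFiniteMeasure ρ] (x : ℝ) {ε : ℝ}
    (hε : 0 < ε) : ∃ r > 0, ρ.real (Set.Ioo (x - r) (x + r) \ {x}) < ε := by
  -- Outer regularity at the point: an open set around x whose mass exceeds that of the possible
  -- atom {x} by less than ε.
  obtain ⟨U, hxU, hU, hlt⟩ := Set.exists_isOpen_lt_add (μ := ρ) {x} (measure_ne_top _ _)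
    (ENNReal.ofReal_pos.2 hε).ne'
  obtain ⟨r, hr, hball⟩ := Metric.isOpen_iff.1 hU x (hxU rfl)
  refine ⟨r, hr, ?_⟩
  have h1 : ρ.real (Set.Ioo (x - r) (x + r) \ {x}) ≤ ρ.real (U \ {x}) := by
    refine measureReal_mono (Set.sdiff_subset_sdiff_left ?_)
    rwa [← Real.ball_eq_Ioo]
  have h2 : ρ.real (U \ {x}) + ρ.real {x} = ρ.real U := by
    have h := measureReal_sdiff_add_inter (μ := ρ) (s := U) (measurableSet_singleton x)
    rwa [Set.inter_eq_self_of_subset_right hxU] at h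
  have h3 : ρ.real U < ρ.real {x} + ε := by
    have := ENNReal.toReal_strict_mono (by finiteness) hlt
    rwa [ENNReal.toReal_add (by finiteness) (by finiteness), ENNReal.toReal_ofReal hε.le] at this
  linarith

/-- The sublevel sets of a bounded function have finite bracketing. -/
theorem sublevel (ρ : Measure α) [IsFiniteMeasure ρ] {f : α → ℝ} (hf : Measurable f) {u v : ℝ}
    (huv : ∀ x, f x ∈ Set.Icc u v) :
    HasFiniteBracketing ρ (Set.range fun γ : ℝ => {x | f x ≤ γ}) := by
  intro ε hε
  choose r hr hrε using fun x => exists_Ioo_diff_singleton_lt (ρ.map f) x hε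
  obtain ⟨t, -, ht⟩ := (isCompact_Icc (a := u) (b := v)).elim_nhds_subcover
    (fun x => Set.Ioo (x - r x) (x + r x))
    (fun x _ => Ioo_mem_nhds (by linarith [hr x]) (by linarith [hr x]))
  have hsub : ∀ x, ∀ s ⊆ Set.Ioo (x - r x) (x + r x) \ {x}, MeasurableSet s →
      ρ.real (f ⁻¹' s) < ε := by
    intro x s hs hms
    rw [← map_measureReal_apply hf hms]
    exact (measureReal_mono hs).trans_lt (hrε x)
  -- Thresholds outside [u, v] give the trivial brackets. A threshold in the interval around x falls
  -- either in (x - r, x) or in [x, x + r). The two corresponding brackets both have gaps that avoid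
  -- the level f = x, so an atom there does no harm.
  refine ⟨{(∅, ∅), (Set.univ, Set.univ)} ∪
    ((fun x => ({z | f z ≤ x - r x}, {z | f z < x})) '' t ∪
      (fun x => ({z | f z ≤ x}, {z | f z < x + r x})) '' t), ?_, ?_, ?_⟩
  · exact (Set.toFinite _).union ((t.finite_toSet.image _).union (t.finite_toSet.image _))
  · rintro p ((rfl | rfl) | ⟨x, -, rfl⟩ | ⟨x, -, rfl⟩)
    · simpa using hε
    · simpa using hε
    · refine ⟨measurableSet_le hf measurable_const, measurableSet_lt hf measurable_const, ?_⟩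
      refine lt_of_eq_of_lt ?_ (hsub x (Set.Ioo (x - r x) x) ?_ measurableSet_Ioo)
      · congr 1; ext z; simp [and_comm]
      · rintro y ⟨h1, h2⟩
        exact ⟨⟨h1, by linarith [hr x]⟩, h2.ne⟩
    · refine ⟨measurableSet_le hf measurable_const, measurableSet_lt hf measurable_const, ?_⟩
      refine lt_of_eq_of_lt ?_ (hsub x (Set.Ioo x (x + r x)) ?_ measurableSet_Ioo)
      · congr 1; ext z; simp [and_comm]
      · rintro y ⟨h1, h2⟩
        exact ⟨⟨by linarith [hr x], h2⟩, h1.ne'⟩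
  · rintro _ ⟨γ, rfl⟩
    rcases lt_or_ge γ u with hγ | hγ
    · refine ⟨(∅, ∅), by simp, by simp, ?_⟩
      intro z hz
      exact absurd (hz : f z ≤ γ) (not_le.2 (hγ.trans_le (huv z).1))
    rcases lt_or_ge v γ with hγ' | hγ'
    · refine ⟨(Set.univ, Set.univ), by simp, ?_, by simp⟩
      intro z _
      exact (huv z).2.trans hγ'.le
    obtain ⟨x, hx, hγx⟩ := Set.mem_iUnion₂.1 (ht ⟨hγ, hγ'⟩)
    rcases lt_or_ge γ x with h | h
    · exact ⟨_, Or.inr (Or.inl ⟨x, hx, rfl⟩), fun z hz => le_trans hz hγx.1.le,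
        fun z hz => lt_of_le_of_lt hz h⟩
    · exact ⟨_, Or.inr (Or.inr ⟨x, hx, rfl⟩), fun z hz => le_trans hz h,
        fun z hz => lt_of_le_of_lt hz hγx.2⟩

end HasFiniteBracketing

section LLN

variable {Ω β : Type*} [MeasurableSpace Ω] [MeasurableSpace β] {P : Measure Ω}

theorem ae_tendsto_average [IsProbabilityMeasure P] {O : ℕ → Ω → β} (hO : ∀ i, Measurable (O i))
    (hind : iIndepFun O P) (hlaw : ∀ i, P.map (O i) = P.map (O 0)) {h : β → ℝ} (hh : Measurable h)
    (hint : Integrable h (P.map (O 0))) :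
    ∀ᵐ ω ∂P, Tendsto (fun n : ℕ => (∑ i ∈ Finset.range n, h (O i ω)) / n) atTop
      (𝓝 (∫ y, h y ∂(P.map (O 0)))) := by
  have := strong_law_ae_real (μ := P) (fun i ω => h (O i ω)) (hint.comp_measurable (hO 0))
    (fun i j hij => (hind.indepFun hij).comp hh hh)
    (fun i => (IdentDistrib.mk (hO i).aemeasurable (hO 0).aemeasurable (hlaw i)).comp hh)
  rwa [integral_map (hO 0).aemeasurable hh.aestronglyMeasurable]

/-- Uniform strong law of large numbers over a class of sets with finite bracketing. -/
theorem ae_uniform_average [IsProbabilityMeasure P] {O : ℕ → Ω → β} (hO : ∀ i, Measurable (O i))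
    (hind : iIndepFun O P) (hlaw : ∀ i, P.map (O i) = P.map (O 0)) {g : β → ℝ} (hg : Measurable g)
    {K : ℝ} (hK : ∀ᵐ y ∂(P.map (O 0)), |g y| ≤ K) {𝒞 : Set (Set β)}
    (h𝒞 : HasFiniteBracketing (P.map (O 0)) 𝒞) :
    ∀ᵐ ω ∂P, ∀ ε > 0, ∀ᶠ n : ℕ in atTop, ∀ C ∈ 𝒞,
      |(∑ i ∈ Finset.range n, C.indicator g (O i ω)) / n - ∫ y in C, g y ∂(P.map (O 0))| ≤ ε := by
  set ρ := P.map (O 0) with hρ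
  have : IsProbabilityMeasure ρ := Measure.isProbabilityMeasure_map (hO 0).aemeasurable
  have hgint : Integrable g ρ :=
    Integrable.of_bound hg.aestronglyMeasurable K (by simpa using hK)
  have hK0 : 0 ≤ K := by
    obtain ⟨y, hy⟩ := hK.exists
    exact (abs_nonneg _).trans hy
  -- Bracket sizes 1/(m + 1) keep the exceptional null sets countable in number; ε is only chosen
  -- after ω.
  choose F hF hF1 hF2 using fun m : ℕ => h𝒞 (1 / ((m : ℝ) + 1)) (by positivity)
  have hA : ∀ᵐ ω ∂P, ∀ m, ∀ p ∈ F m,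
      Tendsto (fun n : ℕ => (∑ i ∈ Finset.range n, p.1.indicator g (O i ω)) / n) atTop
        (𝓝 (∫ y in p.1, g y ∂ρ)) := by
    refine ae_all_iff.2 fun m => (ae_ball_iff (hF m).countable).2 fun p hp => ?_
    have h1 := (hF1 m p hp).1
    rw [← integral_indicator h1]
    exact ae_tendsto_average hO hind hlaw (hg.indicator h1) (hgint.indicator h1)
  have hD : ∀ᵐ ω ∂P, ∀ m, ∀ p ∈ F m,
      Tendsto (fun n : ℕ => (∑ i ∈ Finset.range n, (p.2 \ p.1).indicator (1 : β → ℝ) (O i ω)) / n)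
        atTop (𝓝 (ρ.real (p.2 \ p.1))) := by
    refine ae_all_iff.2 fun m => (ae_ball_iff (hF m).countable).2 fun p hp => ?_
    have h1 := (hF1 m p hp).2.1.diff (hF1 m p hp).1
    rw [← integral_indicator_one h1]
    exact ae_tendsto_average hO hind hlaw (measurable_one.indicator h1)
      ((integrable_const (1 : ℝ)).indicator h1)
  have hB : ∀ᵐ ω ∂P, ∀ i, |g (O i ω)| ≤ K := by
    refine ae_all_iff.2 fun i => ?_
    rw [← hlaw i] at hK
    exact ae_of_ae_map (hO i).aemeasurable hK
  filter_upwards [hA, hD, hB] with ω hA hD hB ε hε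
  -- The error budget in units of the bracket size η: 1 from the law of large numbers on the lower
  -- bracket, 2K from the empirical mass of the gap, which is eventually below 2η, and K from its
  -- population mass.
  obtain ⟨m, hm⟩ := exists_nat_one_div_lt (show 0 < ε / (1 + 3 * K) by positivity)
  set η : ℝ := 1 / ((m : ℝ) + 1) with hη
  have hη0 : 0 < η := by positivity
  have hηε : (1 + 3 * K) * η ≤ ε := by
    rw [lt_div_iff₀ (by positivity)] at hm
    linarith
  have hev : ∀ᶠ n : ℕ in atTop, ∀ p ∈ F m,
      |(∑ i ∈ Finset.range n, p.1.indicator g (O i ω)) / n - ∫ y in p.1, g y ∂ρ| < η ∧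
      (∑ i ∈ Finset.range n, (p.2 \ p.1).indicator (1 : β → ℝ) (O i ω)) / n < 2 * η := by
    refine (eventually_all_finite (hF m)).2 fun p hp => ?_
    refine ((Metric.tendsto_nhds.1 (hA m p hp)) η hη0).and ?_
    exact (hD m p hp).eventually_lt_const (by linarith [(hF1 m p hp).2.2])
  filter_upwards [hev] with n hn C hC
  obtain ⟨p, hp, hpC, hCp⟩ := hF2 m C hC
  obtain ⟨hn1, hn2⟩ := hn p hp
  obtain ⟨hm1, hm2, hm3⟩ := hF1 m p hp
  have e1 : |(∑ i ∈ Finset.range n, C.indicator g (O i ω)) / n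
      - (∑ i ∈ Finset.range n, p.1.indicator g (O i ω)) / n| ≤
      K * ((∑ i ∈ Finset.range n, (p.2 \ p.1).indicator (1 : β → ℝ) (O i ω)) / n) := by
    rw [← sub_div, ← Finset.sum_sub_distrib, abs_div, Nat.abs_cast, ← mul_div_assoc,
      Finset.mul_sum]
    gcongr
    refine (Finset.abs_sum_le_sum_abs _ _).trans (Finset.sum_le_sum fun i _ => ?_)
    have hb := hB i
    by_cases h1 : O i ω ∈ p.1
    · simp [h1, hpC h1]
    by_cases h2 : O i ω ∈ C
    · simpa [h1, h2, hCp h2] using hb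
    · simp only [h1, h2, not_false_eq_true, Set.indicator_of_notMem, sub_zero, abs_zero]
      exact mul_nonneg hK0 (Set.indicator_nonneg (by simp) _)
  -- The set C itself need not be measurable; measurability of the lower bracket is enough to split
  -- the integral.
  have e2 : |(∫ y in C, g y ∂ρ) - ∫ y in p.1, g y ∂ρ| ≤ K * η := by
    have h3 : (∫ y in C, g y ∂ρ) - ∫ y in p.1, g y ∂ρ = ∫ y in C \ p.1, g y ∂ρ := by
      rw [setIntegral_sdiff hm1 hgint.integrableOn hpC]
    rw [h3]
    have h4 := norm_setIntegral_le_of_norm_le_const_ae (μ := ρ) (s := C \ p.1) (f := g) (C := K)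
      (measure_lt_top _ _) (ae_restrict_of_ae (by simpa using hK))
    refine h4.trans ?_
    gcongr
    exact (measureReal_mono (Set.sdiff_subset_sdiff_left hCp)).trans hm3.le
  have e3 : K * ((∑ i ∈ Finset.range n, (p.2 \ p.1).indicator (1 : β → ℝ) (O i ω)) / n) ≤
      K * (2 * η) := by gcongr
  rw [abs_le] at e1 e2 ⊢
  rw [abs_lt] at hn1
  constructor <;> linarith [e1.1, e1.2, e2.1, e2.2, hn1.1, hn1.2]

end LLN

variable {d : ℕ} {b c : Fin d → ℝ}

/-! ### The cells of tree partitions -/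

variable (b c) in
/-- The half-spaces `{x_j ≤ γ}` and `{x_j > γ}`, the empty set and the whole space. -/
def halfSpaces : Set (Set (CovSpace b c)) :=
  let lower : Set (Set (CovSpace b c)) :=
    ({∅} ∪ {Set.univ}) ∪ ⋃ j, Set.range fun γ : ℝ => {x | x.1 j ≤ γ}
  lower ∪ Compl.compl '' lower

variable (b c) in
/-- Intersections of `L + 1` half-spaces. -/
def cells : ℕ → Set (Set (CovSpace b c))
  | 0 => halfSpaces b c
  | L + 1 => Set.image2 (· ∩ ·) (halfSpaces b c) (cells L)

theorem measurable_coord (j : Fin d) : Measurable fun x : CovSpace b c => x.1 j :=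
  (measurable_pi_apply j).comp measurable_subtype_coe

theorem univ_mem_halfSpaces : (Set.univ : Set (CovSpace b c)) ∈ halfSpaces b c :=
  Or.inl (Or.inl (Or.inr rfl))

theorem empty_mem_halfSpaces : (∅ : Set (CovSpace b c)) ∈ halfSpaces b c :=
  Or.inl (Or.inl (Or.inl rfl))

theorem le_mem_halfSpaces (j : Fin d) (γ : ℝ) :
    {x : CovSpace b c | x.1 j ≤ γ} ∈ halfSpaces b c :=
  Or.inl (Or.inr (Set.mem_iUnion.2 ⟨j, γ, rfl⟩))

theorem lt_mem_halfSpaces (j : Fin d) (γ : ℝ) :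
    {x : CovSpace b c | γ < x.1 j} ∈ halfSpaces b c :=
  Or.inr ⟨_, Or.inr (Set.mem_iUnion.2 ⟨j, γ, rfl⟩), by ext; simp⟩

theorem univ_mem_cells : ∀ L, (Set.univ : Set (CovSpace b c)) ∈ cells b c L
  | 0 => univ_mem_halfSpaces
  | L + 1 => ⟨_, univ_mem_halfSpaces, _, univ_mem_cells L, Set.univ_inter _⟩

theorem measurableSet_of_mem_halfSpaces {H : Set (CovSpace b c)} (hH : H ∈ halfSpaces b c) :
    MeasurableSet H := by
  have key : ∀ H ∈ ({∅} ∪ {Set.univ}) ∪ ⋃ j, Set.range fun γ : ℝ => {x : CovSpace b c | x.1 j ≤ γ},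
      MeasurableSet H := by
    rintro H ((rfl | rfl) | hH)
    · exact MeasurableSet.empty
    · exact MeasurableSet.univ
    · obtain ⟨j, γ, rfl⟩ := Set.mem_iUnion.1 hH
      exact measurableSet_le (measurable_coord j) measurable_const
  rcases hH with hH | ⟨H, hH, rfl⟩
  exacts [key _ hH, (key _ hH).compl]

theorem measurableSet_of_mem_cells {L : ℕ} {C : Set (CovSpace b c)} (hC : C ∈ cells b c L) :
    MeasurableSet C := by
  induction L generalizing C with
  | zero => exact measurableSet_of_mem_halfSpaces hC
  | succ L ih =>
    obtain ⟨H, hH, D, hD, rfl⟩ := hC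
    exact (measurableSet_of_mem_halfSpaces hH).inter (ih hD)

theorem hasFiniteBracketing_halfSpaces (ρ : Measure (CovSpace b c)) [IsFiniteMeasure ρ] :
    HasFiniteBracketing ρ (halfSpaces b c) := by
  have h : HasFiniteBracketing ρ (({∅} ∪ {Set.univ}) ∪
      ⋃ j, Set.range fun γ : ℝ => {x : CovSpace b c | x.1 j ≤ γ}) :=
    ((HasFiniteBracketing.singleton ρ .empty).union (.singleton ρ .univ)).union
      (.iUnion fun j => .sublevel ρ (measurable_coord j) fun x => ⟨x.2.1 j, x.2.2 j⟩)
  exact h.union h.compl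

theorem hasFiniteBracketing_cells (ρ : Measure (CovSpace b c)) [IsFiniteMeasure ρ] :
    ∀ L, HasFiniteBracketing ρ (cells b c L)
  | 0 => hasFiniteBracketing_halfSpaces ρ
  | L + 1 => (hasFiniteBracketing_halfSpaces ρ).inter (hasFiniteBracketing_cells ρ L)

/-- The two sides of a cut use different labels, so a fibre lives on one side only. It is therefore
the half-space of that side intersected with a cell one level down. A leaf with another label is why
the empty set is admitted among the half-spaces. -/
theorem FormsTreePartition.exists_cell {ι : Type} {S : CovSpace b c → ι} {L : ℕ}
    {Γ : Set (CovSpace b c)} (h : FormsTreePartition S L Γ) (k : ι) :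
    ∃ C ∈ cells b c L, ∀ x ∈ Γ, S x = k ↔ x ∈ C := by
  induction L generalizing Γ with
  | zero =>
    obtain ⟨k', hk'⟩ := h
    by_cases hk : k' = k
    · exact ⟨_, univ_mem_halfSpaces, fun x hx => by simp [hk' x hx, hk]⟩
    · exact ⟨_, empty_mem_halfSpaces, fun x hx => by simp [hk' x hx, hk]⟩
  | succ L ih =>
    obtain ⟨j, γ, h1, h2, h3⟩ := h
    obtain ⟨C, hC, hCk⟩ := ih h1
    obtain ⟨D, hD, hDk⟩ := ih h2
    -- If the label occurs below the cut it cannot occur above; if it does not, whatever is left of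
    -- the fibre lies above.
    by_cases hne : ∃ x ∈ Γ, x.1 j ≤ γ ∧ S x = k
    · obtain ⟨x₀, hx₀, hxγ, hxk⟩ := hne
      refine ⟨_, ⟨_, le_mem_halfSpaces j γ, C, hC, rfl⟩, fun x hx => ?_⟩
      rcases le_or_gt (x.1 j) γ with hle | hlt
      · simp [hle, hCk x ⟨hx, hle⟩]
      · have : S x ≠ k := fun hk => h3 x₀ hx₀ x hx hxγ hlt (hxk.trans hk.symm)
        simp [hlt, this]
    · refine ⟨_, ⟨_, lt_mem_halfSpaces j γ, D, hD, rfl⟩, fun x hx => ?_⟩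
      rcases le_or_gt (x.1 j) γ with hle | hlt
      · have : S x ≠ k := fun hk => hne ⟨x, hx, hle, hk⟩
        simp [hle.not_gt, this]
      · simp [hlt, hDk x ⟨hx, hlt⟩]

/-- The stratum `S⁻¹(k)`. -/
def StratTree.stratum {L : ℕ} (T : StratTree b c L) (k : Fin (2 ^ L)) : Set (CovSpace b c) :=
  {x | T.S x = k}

theorem StratTree.stratum_mem_cells {L : ℕ} (T : StratTree b c L) (k : Fin (2 ^ L)) :
    T.stratum k ∈ cells b c L := by
  obtain ⟨C, hC, h⟩ := T.isTree.exists_cell k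
  convert hC
  ext x
  exact h x trivial

theorem StratTree.measurableSet_stratum {L : ℕ} (T : StratTree b c L) (k : Fin (2 ^ L)) :
    MeasurableSet (T.stratum k) :=
  measurableSet_of_mem_cells (T.stratum_mem_cells k)

/-! ### Moments -/

/-- The restricted moment `E[Y(a)^r 1{X ∈ C}]`. -/
def moment (Q : Measure (PotUnit b c)) (a : Bool) (r : ℕ) (C : Set (CovSpace b c)) : ℝ :=
  ∫ z in {z | z.2.2 ∈ C}, pot a z ^ r ∂Q

/-- The empirical moment `n⁻¹ ∑ Y_j^r 1{A_j = a, X_j ∈ C}`. -/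
def empMoment {n : ℕ} (w : Fin n → Obs b c) (a : Bool) (r : ℕ) (C : Set (CovSpace b c)) : ℝ :=
  (∑ j, {o : Obs b c | o.2.1 = a ∧ o.2.2 ∈ C}.indicator (fun o => o.1 ^ r) (w j)) / n

/-- The probability of treatment `a` when treatment `1` has probability `q`. -/
def armProb (q : ℝ) (a : Bool) : ℝ := if a = true then q else 1 - q

theorem measurable_pot (a : Bool) : Measurable (pot a : PotUnit b c → ℝ) := by
  cases a
  · exact measurable_fst.comp measurable_snd
  · exact measurable_fst

theorem measurable_covariate : Measurable fun z : PotUnit b c => z.2.2 :=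
  measurable_snd.comp measurable_snd

theorem measurable_covariate_obs : Measurable fun o : Obs b c => o.2.2 :=
  measurable_snd.comp measurable_snd

theorem measurable_observe : Measurable fun p : PotUnit b c × Bool => observe p.1 p.2 :=
  measurable_from_prod_countable_left fun a =>
    (measurable_pot a).prodMk (measurable_const.prodMk measurable_covariate)

namespace SimpleRandomAssignment

variable {Ω : Type*} [MeasurableSpace Ω] {P : Measure Ω} {Q : Measure (PotUnit b c)} {q : ℝ}
  {Z : ℕ → Ω → PotUnit b c} {A : ℕ → Ω → Bool}

theorem measurable_pair (h : SimpleRandomAssignment P Q q Z A) (j : ℕ) :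
    Measurable fun ω => (Z j ω, A j ω) :=
  (h.measurable_unit j).prodMk (h.measurable_assignment j)

theorem measurable_obs (h : SimpleRandomAssignment P Q q Z A) (j : ℕ) :
    Measurable fun ω => observe (Z j ω) (A j ω) :=
  measurable_observe.comp (h.measurable_pair j)

theorem indep_obs (h : SimpleRandomAssignment P Q q Z A) :
    iIndepFun (fun j ω => observe (Z j ω) (A j ω)) P :=
  h.indep_across.comp (fun _ p => observe p.1 p.2) fun _ => measurable_observe

theorem measurable_pilot (h : SimpleRandomAssignment P Q q Z A) (n : ℕ) :
    Measurable (pilot Z A n) :=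
  measurable_pi_iff.2 fun j => h.measurable_obs j

variable [IsProbabilityMeasure P]

theorem map_assignment (h : SimpleRandomAssignment P Q q Z A) (i j : ℕ) :
    P.map (A i) = P.map (A j) := by
  have hp : ∀ i, IsProbabilityMeasure (P.map (A i)) := fun i =>
    Measure.isProbabilityMeasure_map (h.measurable_assignment i).aemeasurable
  have ht : ∀ i, P.map (A i) {true} = ENNReal.ofReal q := fun i => by
    rw [Measure.map_apply (h.measurable_assignment i) (measurableSet_singleton _), ← h.prob_treated i]
    rfl
  have hf : ∀ i, P.map (A i) {false} = 1 - ENNReal.ofReal q := fun i => by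
    rw [show ({false} : Set Bool) = {true}ᶜ by ext x; cases x <;> simp,
      prob_compl_eq_one_sub (measurableSet_singleton _), ht]
  refine Measure.ext_of_singleton fun a => ?_
  cases a
  · rw [hf, hf]
  · rw [ht, ht]

theorem map_obs (h : SimpleRandomAssignment P Q q Z A) (i j : ℕ) :
    P.map (fun ω => observe (Z i ω) (A i ω)) = P.map fun ω => observe (Z j ω) (A j ω) := by
  have key : ∀ i, P.map (fun ω => observe (Z i ω) (A i ω)) =
      (Q.prod (P.map (A 0))).map fun p => observe p.1 p.2 := fun i => by
    have h1 := (indepFun_iff_map_prod_eq_prod_map_map (h.measurable_unit i).aemeasurable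
      (h.measurable_assignment i).aemeasurable).1 (h.indep_unit_assignment i)
    rw [h.law_unit, h.map_assignment i 0] at h1
    rw [← h1, Measure.map_map measurable_observe (h.measurable_pair i)]
    rfl
  rw [key, key]

theorem real_assignment (h : SimpleRandomAssignment P Q q Z A) (hq0 : 0 ≤ q) (a : Bool) :
    P.real {ω | A 0 ω = a} = armProb q a := by
  have ht : P.real {ω | A 0 ω = true} = q := by
    rw [measureReal_def, h.prob_treated, ENNReal.toReal_ofReal hq0]
  cases a
  · have hm : MeasurableSet {ω | A 0 ω = true} :=
      h.measurable_assignment 0 (measurableSet_singleton true)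
    rw [show {ω | A 0 ω = false} = {ω | A 0 ω = true}ᶜ by ext; simp,
      probReal_compl_eq_one_sub hm, ht]
    simp [armProb]
  · simpa [armProb] using ht

/-- On {A = a} the observed outcome is Y(a), and the coin is independent of the unit, so the
expectation factors. This identifies the limit in the strong law. -/
theorem setIntegral_obs (h : SimpleRandomAssignment P Q q Z A) (hq0 : 0 ≤ q) (a : Bool) (r : ℕ)
    {C : Set (CovSpace b c)} (hC : MeasurableSet C) :
    ∫ o in (fun o : Obs b c => o.2.2) ⁻¹' C, {o : Obs b c | o.2.1 = a}.indicator (fun o => o.1 ^ r) o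
      ∂(P.map fun ω => observe (Z 0 ω) (A 0 ω)) = armProb q a * moment Q a r C := by
  have hC1 : MeasurableSet ((fun o : Obs b c => o.2.2) ⁻¹' C) := measurable_covariate_obs hC
  have hC2 : MeasurableSet {z : PotUnit b c | z.2.2 ∈ C} := measurable_covariate hC
  have ha : MeasurableSet {o : Obs b c | o.2.1 = a} :=
    (measurable_fst.comp measurable_snd) (measurableSet_singleton a)
  have hm : Measurable fun o : Obs b c => o.1 ^ r := measurable_fst.pow_const r
  rw [← integral_indicator hC1, integral_map (h.measurable_obs 0).aemeasurable
    ((hm.indicator ha).indicator hC1).aestronglyMeasurable]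
  have hφ : Measurable ({z : PotUnit b c | z.2.2 ∈ C}.indicator fun z => pot a z ^ r) :=
    ((measurable_pot a).pow_const r).indicator hC2
  have hψ : Measurable (({a} : Set Bool).indicator (1 : Bool → ℝ)) := measurable_of_finite _
  have hprod := ((h.indep_unit_assignment 0).comp hφ hψ).integral_mul_eq_mul_integral
    (hφ.comp (h.measurable_unit 0)).aestronglyMeasurable
    (hψ.comp (h.measurable_assignment 0)).aestronglyMeasurable
  have e1 : ∫ ω, ({z : PotUnit b c | z.2.2 ∈ C}.indicator (fun z => pot a z ^ r) ∘ Z 0) ω ∂P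
      = moment Q a r C := by
    rw [moment, ← integral_indicator hC2, ← h.law_unit 0,
      integral_map (h.measurable_unit 0).aemeasurable hφ.aestronglyMeasurable]
    rfl
  have e2 : ∫ ω, ((({a} : Set Bool).indicator (1 : Bool → ℝ)) ∘ A 0) ω ∂P = armProb q a := by
    have hm : MeasurableSet {ω | A 0 ω = a} :=
      h.measurable_assignment 0 (measurableSet_singleton a)
    rw [← h.real_assignment hq0 a, ← integral_indicator_one hm]
    rfl
  rw [e1, e2] at hprod
  rw [mul_comm (armProb q a), ← hprod]
  congr 1
  ext ω
  by_cases hA : A 0 ω = a <;> by_cases hX : (Z 0 ω).2.2 ∈ C <;> simp [observe, hA, hX]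

/-- Any `n` distinct units give a sample with the law of the pilot sample of size `n`. -/
theorem map_subsample (h : SimpleRandomAssignment P Q q Z A) {n : ℕ} {f : Fin n → ℕ}
    (hf : Function.Injective f) :
    P.map (fun ω j => observe (Z (f j) ω) (A (f j) ω)) = P.map (pilot Z A n) := by
  -- By independence and equality of marginals, each such sample has the same product law, whatever
  -- the indices.
  have key : ∀ f : Fin n → ℕ, Function.Injective f →
      P.map (fun ω j => observe (Z (f j) ω) (A (f j) ω)) =
        Measure.pi fun _ => P.map fun ω => observe (Z 0 ω) (A 0 ω) := fun f hf => by
    rw [(iIndepFun_iff_map_fun_eq_pi_map fun j => (h.measurable_obs (f j)).aemeasurable).1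
      (h.indep_obs.precomp hf)]
    congr 1
    ext1 j
    exact h.map_obs _ _
  rw [key f hf, ← key _ Fin.val_injective]
  rfl

/-- Uniform strong law for the empirical moments over cells of bounded depth. -/
theorem ae_uniform_empMoment (h : SimpleRandomAssignment P Q q Z A) (hq0 : 0 ≤ q) {M : ℝ}
    (hM : ∀ᵐ z ∂Q, ∀ a, |pot a z| ≤ M) (L : ℕ) (a : Bool) (r : ℕ) :
    ∀ᵐ ω ∂P, ∀ ε > 0, ∀ᶠ n : ℕ in atTop, ∀ C ∈ cells b c L,
      |empMoment (pilot Z A n ω) a r C - armProb q a * moment Q a r C| ≤ ε := by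
  have ha : MeasurableSet {o : Obs b c | o.2.1 = a} :=
    (measurable_fst.comp measurable_snd) (measurableSet_singleton a)
  have hm : Measurable fun o : Obs b c => o.1 ^ r := measurable_fst.pow_const r
  have hprob : IsProbabilityMeasure (P.map fun ω => observe (Z 0 ω) (A 0 ω)) :=
    Measure.isProbabilityMeasure_map (h.measurable_obs 0).aemeasurable
  have hK : ∀ᵐ o ∂(P.map fun ω => observe (Z 0 ω) (A 0 ω)),
      |{o : Obs b c | o.2.1 = a}.indicator (fun o => o.1 ^ r) o| ≤ M ^ r := by
    rw [ae_map_iff (h.measurable_obs 0).aemeasurable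
      (measurableSet_le (hm.indicator ha).abs measurable_const)]
    rw [← h.law_unit 0] at hM
    filter_upwards [ae_of_ae_map (h.measurable_unit 0).aemeasurable hM] with ω hω
    have h0 : 0 ≤ M := (abs_nonneg _).trans (hω a)
    by_cases hA : A 0 ω = a
    · simp only [observe, hA, Set.mem_ofPred_eq, Set.indicator_of_mem, abs_pow]
      exact pow_le_pow_left₀ (abs_nonneg _) (hω a) r
    · simpa [observe, hA] using pow_nonneg h0 r
  filter_upwards [ae_uniform_average h.measurable_obs h.indep_obs (fun i => h.map_obs i 0)
    (hm.indicator ha) hK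
    ((hasFiniteBracketing_cells _ L).preimage measurable_covariate_obs)] with ω hω ε hε
  filter_upwards [hω ε hε] with n hn C hC
  have := hn _ ⟨C, hC, rfl⟩
  rw [h.setIntegral_obs hq0 a r (measurableSet_of_mem_cells hC)] at this
  convert this using 4
  rw [← Fin.sum_univ_eq_sum_range (fun i => ((fun o : Obs b c => o.2.2) ⁻¹' C).indicator
    ({o : Obs b c | o.2.1 = a}.indicator fun o => o.1 ^ r) (observe (Z i ω) (A i ω)))]
  unfold empMoment
  congr 1
  refine Finset.sum_congr rfl fun j _ => ?_
  rw [Set.indicator_indicator]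
  congr 1
  ext o
  simp [and_comm]

end SimpleRandomAssignment

/-- The full-sample moment is the average of those of the two halves. Consistency of the second half
thus follows from that of the full sample and the first half, with no further strong law. Empty
samples have zero moments by the convention for division by 0. -/
theorem empMoment_fold2 {n : ℕ} (w : Fin (n + n) → Obs b c) (a : Bool) (r : ℕ)
    (C : Set (CovSpace b c)) :
    empMoment (fold2 w) a r C = 2 * empMoment w a r C - empMoment (fold1 w) a r C := by
  simp only [empMoment, Fin.sum_univ_add, fold1, fold2, Nat.cast_add]
  rcases eq_or_ne (n : ℝ) 0 with h | h
  · simp [h]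
  · field_simp
    ring

/-! ### Asymptotically equal bounded families -/

/-- `u - v → 0` along `l`, and `v` is bounded. -/
structure AsympClose {ι : Type*} (l : Filter ι) (u v : ι → ℝ) : Prop where
  tendsto : Tendsto (fun i => u i - v i) l (𝓝 0)
  bounded : ∃ M, ∀ᶠ i in l, |v i| ≤ M

namespace AsympClose

variable {ι : Type*} {l : Filter ι} {u v u' v' : ι → ℝ}

theorem refl (h : ∃ M, ∀ᶠ i in l, |v i| ≤ M) : AsympClose l v v :=
  ⟨by simp [tendsto_const_nhds], h⟩

theorem mono {l' : Filter ι} (h : AsympClose l u v) (hl : l' ≤ l) : AsympClose l' u v :=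
  ⟨h.tendsto.mono_left hl, h.bounded.imp fun _ hM => hM.filter_mono hl⟩

theorem congr' (h : AsympClose l u v) (hu : u =ᶠ[l] u') (hv : v =ᶠ[l] v') : AsympClose l u' v' :=
  ⟨h.tendsto.congr' (hu.sub hv), h.bounded.imp fun M hM => by
    filter_upwards [hM, hv] with i hi hi'
    rwa [← hi']⟩

theorem add (h : AsympClose l u v) (h' : AsympClose l u' v') :
    AsympClose l (fun i => u i + u' i) fun i => v i + v' i := by
  refine ⟨?_, ?_⟩
  · have := h.tendsto.add h'.tendsto
    rw [add_zero] at this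
    exact this.congr fun i => by ring
  · obtain ⟨M, hM⟩ := h.bounded
    obtain ⟨M', hM'⟩ := h'.bounded
    refine ⟨M + M', ?_⟩
    filter_upwards [hM, hM'] with i hi hi'
    exact (abs_add_le _ _).trans (add_le_add hi hi')

theorem neg (h : AsympClose l u v) : AsympClose l (fun i => -u i) fun i => -v i := by
  refine ⟨?_, ?_⟩
  · have := h.tendsto.neg
    rw [neg_zero] at this
    exact this.congr fun i => by ring
  · simpa only [abs_neg] using h.bounded

theorem sub (h : AsympClose l u v) (h' : AsympClose l u' v') :
    AsympClose l (fun i => u i - u' i) fun i => v i - v' i := by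
  simpa only [sub_eq_add_neg] using h.add h'.neg

theorem mul (h : AsympClose l u v) (h' : AsympClose l u' v') :
    AsympClose l (fun i => u i * u' i) fun i => v i * v' i := by
  obtain ⟨M, hM⟩ := h.bounded
  obtain ⟨M', hM'⟩ := h'.bounded
  refine ⟨?_, M * M', ?_⟩
  · have h1 := bdd_le_mul_tendsto_zero' M hM h'.tendsto
    have h2 := bdd_le_mul_tendsto_zero' M' hM' h.tendsto
    have h3 := h.tendsto.mul h'.tendsto
    have := (h1.add h2).add h3
    simp only [mul_zero, add_zero] at this
    exact this.congr fun i => by ring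
  · filter_upwards [hM, hM'] with i hi hi'
    rw [abs_mul]
    exact mul_le_mul hi hi' (abs_nonneg _) ((abs_nonneg _).trans hi)

/-- The lower bound κ on v passes to κ/2 on u, after which 1/u - 1/v is a bounded factor times u -
v. -/
theorem inv (h : AsympClose l u v) {κ : ℝ} (hκ : 0 < κ) (hv : ∀ᶠ i in l, κ ≤ v i) :
    AsympClose l (fun i => (u i)⁻¹) fun i => (v i)⁻¹ := by
  have hu : ∀ᶠ i in l, κ / 2 ≤ u i := by
    filter_upwards [hv, Metric.tendsto_nhds.1 h.tendsto (κ / 2) (by positivity)] with i hi hi'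
    rw [Real.dist_eq, sub_zero, abs_lt] at hi'
    linarith [hi'.1]
  refine ⟨?_, κ⁻¹, ?_⟩
  · have hb : ∀ᶠ i in l, |-((u i)⁻¹ * (v i)⁻¹)| ≤ (κ / 2)⁻¹ * κ⁻¹ := by
      filter_upwards [hu, hv] with i hi hi'
      have h1 : 0 < u i := lt_of_lt_of_le (by positivity) hi
      have h2 : 0 < v i := lt_of_lt_of_le (by positivity) hi'
      rw [abs_neg, abs_of_pos (by positivity)]
      gcongr
    refine (bdd_le_mul_tendsto_zero' _ hb h.tendsto).congr' ?_
    filter_upwards [hu, hv] with i hi hi'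
    have h1 : 0 < u i := lt_of_lt_of_le (by positivity) hi
    have h2 : 0 < v i := lt_of_lt_of_le (by positivity) hi'
    field_simp
    ring
  · filter_upwards [hv] with i hi
    have h2 : 0 < v i := lt_of_lt_of_le (by positivity) hi
    rw [abs_of_pos (by positivity)]
    gcongr

theorem div (h : AsympClose l u v) (h' : AsympClose l u' v') {κ : ℝ} (hκ : 0 < κ)
    (hv : ∀ᶠ i in l, κ ≤ v' i) : AsympClose l (fun i => u i / u' i) fun i => v i / v' i := by
  simpa only [div_eq_mul_inv] using h.mul (h'.inv hκ hv)

theorem eventually_pos (h : AsympClose l u v) {κ : ℝ} (hκ : 0 < κ) (hv : ∀ᶠ i in l, κ ≤ v i) :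
    ∀ᶠ i in l, 0 < u i := by
  filter_upwards [hv, Metric.tendsto_nhds.1 h.tendsto κ hκ] with i hi hi'
  rw [Real.dist_eq, sub_zero, abs_lt] at hi'
  linarith [hi'.1]

end AsympClose

/-! ### Moment formulas for the two variances -/

section Moments

variable {Q : Measure (PotUnit b c)} {L : ℕ}

theorem moment_zero (a : Bool) (C : Set (CovSpace b c)) :
    moment Q a 0 C = Q.real {z | z.2.2 ∈ C} := by
  simp [moment]

/-- This also holds for null strata: conditioning on a null set gives the zero measure, and the
quotient by 0 is 0. -/
theorem cellMean_pow_eq (T : StratTree b c L) (k : Fin (2 ^ L)) (a : Bool) (r : ℕ) :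
    cellMean Q T k (fun z => pot a z ^ r) =
      moment Q a r (T.stratum k) / moment Q a 0 (T.stratum k) := by
  rw [cellMean, ProbabilityTheory.cond, integral_smul_measure, moment_zero, smul_eq_mul,
    ENNReal.toReal_inv, mul_comm, ← div_eq_mul_inv]
  rfl

theorem integrable_pot_pow [IsFiniteMeasure Q] {M : ℝ} (hM : ∀ᵐ z ∂Q, ∀ a, |pot a z| ≤ M)
    (a : Bool) (r : ℕ) : Integrable (fun z => pot a z ^ r) Q := by
  refine Integrable.of_bound ((measurable_pot a).pow_const r).aestronglyMeasurable (M ^ r) ?_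
  filter_upwards [hM] with z hz
  rw [Real.norm_eq_abs, abs_pow]
  exact pow_le_pow_left₀ (abs_nonneg _) (hz a) r

theorem abs_moment_le [IsProbabilityMeasure Q] {M : ℝ} (hM : ∀ᵐ z ∂Q, ∀ a, |pot a z| ≤ M)
    (a : Bool) (r : ℕ) (C : Set (CovSpace b c)) : |moment Q a r C| ≤ M ^ r := by
  obtain ⟨z, hz⟩ := hM.exists
  have h0 : 0 ≤ M := (abs_nonneg _).trans (hz a)
  have h := norm_setIntegral_le_of_norm_le_const_ae (μ := Q) (s := {z | z.2.2 ∈ C})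
    (f := fun z => pot a z ^ r) (C := M ^ r) (measure_lt_top _ _) (ae_restrict_of_ae (by
      filter_upwards [hM] with z hz
      rw [Real.norm_eq_abs, abs_pow]
      exact pow_le_pow_left₀ (abs_nonneg _) (hz a) r))
  refine h.trans (mul_le_of_le_one_right (by positivity) measureReal_le_one)

/-- The contribution of a stratum, as a function of its weight `p`, the means `x a`, the second
moments `y a`, the overall mean difference `D` and the target `t`. -/
def cellTerm (p : ℝ) (x y : Bool → ℝ) (D t : ℝ) : ℝ :=
  p * ((x true - x false - D) ^ 2 +
    ((y false - x false ^ 2) / (1 - t) + (y true - x true ^ 2) / t))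

/-- Puts V in the same shape as `empVarReal`, so that the two can be compared moment by moment. The
overall means are written as ratios over the whole space because their empirical versions have a
random denominator. -/
theorem V_eq [IsProbabilityMeasure Q] {M : ℝ} (hM : ∀ᵐ z ∂Q, ∀ a, |pot a z| ≤ M)
    (T : StratTree b c L) :
    V Q T = ∑ k, cellTerm (moment Q true 0 (T.stratum k))
      (fun a => moment Q a 1 (T.stratum k) / moment Q a 0 (T.stratum k))
      (fun a => moment Q a 2 (T.stratum k) / moment Q a 0 (T.stratum k))
      (moment Q true 1 Set.univ / moment Q true 0 Set.univ
        - moment Q false 1 Set.univ / moment Q false 0 Set.univ) (T.π k) := by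
  have hint : ∀ a, Integrable (pot a) Q := fun a => by
    simpa using integrable_pot_pow hM a 1
  have hcond : ∀ k a, Integrable (pot a) (ProbabilityTheory.cond Q {z | T.S z.2.2 = k}) :=
    fun k a => by
      rcases eq_or_ne (Q {z | T.S z.2.2 = k}) 0 with h | h
      · rw [cond_eq_zero_of_meas_eq_zero h]
        exact integrable_zero_measure
      · exact (hint a).restrict.smul_measure (by simpa using h)
  have huniv : ∀ a, moment Q a 1 Set.univ / moment Q a 0 Set.univ = ∫ z, pot a z ∂Q := fun a => by
    simp [moment]
  have hmean : ∀ k a, cellMean Q T k (pot a) =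
      moment Q a 1 (T.stratum k) / moment Q a 0 (T.stratum k) := fun k a => by
    simpa using cellMean_pow_eq T k a 1
  have hsub : ∀ k, cellMean Q T k (fun z => pot true z - pot false z) =
      cellMean Q T k (pot true) - cellMean Q T k (pot false) := fun k =>
    integral_sub (hcond k true) (hcond k false)
  unfold V cellTerm cellVar
  refine Finset.sum_congr rfl fun k _ => ?_
  have hp : Q.real {z | T.S z.2.2 = k} = moment Q true 0 (T.stratum k) := by
    rw [moment_zero]; rfl
  rw [hsub, integral_sub (hint true) (hint false), huniv, huniv, hmean, hmean, cellMean_pow_eq,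
    cellMean_pow_eq, hp]

variable {n : ℕ}

theorem empMoment_eq (w : Fin n → Obs b c) (T : StratTree b c L) (k : Fin (2 ^ L)) (a : Bool)
    (r : ℕ) : empMoment w a r (T.stratum k) =
      (∑ j with (w j).2.1 = a ∧ T.S (w j).2.2 = k, (w j).1 ^ r) / n := by
  classical
  rw [empMoment, Finset.sum_filter]
  congr 1
  refine Finset.sum_congr rfl fun j _ => ?_
  simp only [Set.indicator_apply]
  exact if_congr Iff.rfl rfl rfl

theorem empMoment_univ (w : Fin n → Obs b c) (a : Bool) (r : ℕ) :
    empMoment w a r Set.univ = (∑ j with (w j).2.1 = a, (w j).1 ^ r) / n := by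
  classical
  rw [empMoment, Finset.sum_filter]
  congr 1
  refine Finset.sum_congr rfl fun j _ => ?_
  simp only [Set.indicator_apply]
  exact if_congr (by simp) rfl rfl

theorem empMoment_zero (w : Fin n → Obs b c) (T : StratTree b c L) (k : Fin (2 ^ L)) (a : Bool) :
    empMoment w a 0 (T.stratum k) = (countArm w T a k : ℝ) / n := by
  simp [empMoment_eq, countArm]

theorem countCell_eq (w : Fin n → Obs b c) (T : StratTree b c L) (k : Fin (2 ^ L)) :
    (countCell w T k : ℝ) / n =
      empMoment w true 0 (T.stratum k) + empMoment w false 0 (T.stratum k) := by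
  rw [empMoment_zero, empMoment_zero, ← add_div]
  congr 1
  norm_cast
  rw [countCell, countArm, countArm,
    ← Finset.card_filter_add_card_filter_not (p := fun j => (w j).2.1 = true)]
  simp [Finset.filter_filter, and_comm]

theorem div_natCast_div_div_natCast (x y : ℝ) (hn : n = 0 → y = 0) : x / n / (y / n) = x / y := by
  rcases Nat.eq_zero_or_pos n with h | h
  · simp [hn h]
  · exact div_div_div_cancel_right₀ (by positivity) x y

theorem empCellMean_eq (w : Fin n → Obs b c) (T : StratTree b c L) (k : Fin (2 ^ L)) (a : Bool)
    (r : ℕ) : empCellMean w T a k (fun y => y ^ r) =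
      empMoment w a r (T.stratum k) / empMoment w a 0 (T.stratum k) := by
  rw [empMoment_eq, empMoment_zero, div_natCast_div_div_natCast, empCellMean]
  rintro rfl
  simp [countArm]

theorem empMean_eq (w : Fin n → Obs b c) (a : Bool) :
    empMean w a = empMoment w a 1 Set.univ / empMoment w a 0 Set.univ := by
  rw [empMoment_univ, empMoment_univ, div_natCast_div_div_natCast, empMean]
  · simp
  · rintro rfl
    simp

/-- The value of the empirical variance when all nonempty strata contain data from both arms. -/
def empVarReal (w : Fin n → Obs b c) (T : StratTree b c L) : ℝ :=
  ∑ k, cellTerm (empMoment w true 0 (T.stratum k) + empMoment w false 0 (T.stratum k))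
    (fun a => empMoment w a 1 (T.stratum k) / empMoment w a 0 (T.stratum k))
    (fun a => empMoment w a 2 (T.stratum k) / empMoment w a 0 (T.stratum k))
    (empMoment w true 1 Set.univ / empMoment w true 0 Set.univ
      - empMoment w false 1 Set.univ / empMoment w false 0 Set.univ) (T.π k)

open Classical in
theorem empVar_eq (w : Fin n → Obs b c) (T : StratTree b c L) :
    empVar w T = if ∀ k, (∃ x, T.S x = k) → ∀ a, 0 < empMoment w a 0 (T.stratum k) then
      (empVarReal w T : EReal) else ⊤ := by
  unfold empVar
  refine if_congr ?_ ?_ rfl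
  · refine forall_congr' fun k => imp_congr_right fun _ => forall_congr' fun a => ?_
    rw [empMoment_zero]
    rcases Nat.eq_zero_or_pos n with rfl | h
    · simp [countArm]
    · rw [div_pos_iff_of_pos_right (by positivity), Nat.cast_pos]
  · congr 1
    unfold empVarReal cellTerm empCellVar
    refine Finset.sum_congr rfl fun k _ => ?_
    have h1 : ∀ a, empCellMean w T a k (fun y => y) =
        empMoment w a 1 (T.stratum k) / empMoment w a 0 (T.stratum k) := fun a => by
      simpa using empCellMean_eq w T k a 1
    rw [countCell_eq, h1, h1, empCellMean_eq, empCellMean_eq, empMean_eq, empMean_eq]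

end Moments

/-! ### Consistency of the empirical variance along sequences of trees -/

/-- The empirical moments of the samples `w n` are uniformly close to the population moments over
cells of bounded depth. -/
def MomentConsistent (Q : Measure (PotUnit b c)) (q : ℝ) {N : ℕ → ℕ}
    (w : ∀ n, Fin (N n) → Obs b c) : Prop :=
  ∀ (L : ℕ) (a : Bool) (r : ℕ) (C : ℕ → Set (CovSpace b c)), (∀ n, C n ∈ cells b c L) →
    Tendsto (fun n => empMoment (w n) a r (C n) - armProb q a * moment Q a r (C n)) atTop (𝓝 0)

variable {Q : Measure (PotUnit b c)} [IsProbabilityMeasure Q]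

/-- A stratum's contribution is polynomial in its arguments except for division by t and 1 - t.
These divisors are common to both sides and at least ν. -/
theorem cellTerm_asympClose {ι : Type*} {l : Filter ι} {p p' D D' t : ι → ℝ}
    {x x' y y' : Bool → ι → ℝ} (hp : AsympClose l p p') (hx : ∀ a, AsympClose l (x a) (x' a))
    (hy : ∀ a, AsympClose l (y a) (y' a)) (hD : AsympClose l D D') {ν : ℝ} (hν : 0 < ν)
    (ht : ∀ i, t i ∈ Set.Icc ν (1 - ν)) :
    AsympClose l (fun i => cellTerm (p i) (fun a => x a i) (fun a => y a i) (D i) (t i))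
      fun i => cellTerm (p' i) (fun a => x' a i) (fun a => y' a i) (D' i) (t i) := by
  have h1 : AsympClose l t t := .refl ⟨1, .of_forall fun i => by
    rw [abs_le]
    constructor <;> linarith [(ht i).1, (ht i).2]⟩
  have h2 : AsympClose l (fun i => 1 - t i) fun i => 1 - t i := .refl ⟨1, .of_forall fun i => by
    rw [abs_le]
    constructor <;> linarith [(ht i).1, (ht i).2]⟩
  unfold cellTerm
  simp only [pow_two]
  have h3 := ((hx true).sub (hx false)).sub hD
  exact hp.mul ((h3.mul h3).add
    ((((hy false).sub ((hx false).mul (hx false))).div h2 hν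
      (.of_forall fun i => by linarith [(ht i).2])).add
    (((hy true).sub ((hx true).mul (hx true))).div h1 hν (.of_forall fun i => (ht i).1))))

theorem armProb_pos {q : ℝ} (hq0 : 0 < q) (hq1 : q < 1) (a : Bool) : 0 < armProb q a := by
  cases a <;> simp [armProb, hq0, hq1]

namespace MomentConsistent

variable {q : ℝ} {N : ℕ → ℕ} {w : ∀ n, Fin (N n) → Obs b c} {M : ℝ}

theorem asympClose (hw : MomentConsistent Q q w) (hM : ∀ᵐ z ∂Q, ∀ a, |pot a z| ≤ M) {L : ℕ}
    (a : Bool) (r : ℕ) {C : ℕ → Set (CovSpace b c)} (hC : ∀ n, C n ∈ cells b c L) :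
    AsympClose atTop (fun n => empMoment (w n) a r (C n))
      fun n => armProb q a * moment Q a r (C n) := by
  refine ⟨hw L a r C hC, |armProb q a| * M ^ r, .of_forall fun n => ?_⟩
  rw [abs_mul]
  gcongr
  exact abs_moment_le hM a r _

/-- The treatment probability appears in numerator and denominator and cancels. The filter is
general because the mass bound will hold only along the indices at which a stratum is nonempty. -/
theorem asympClose_ratio (hw : MomentConsistent Q q w) (hq0 : 0 < q) (hq1 : q < 1)
    (hM : ∀ᵐ z ∂Q, ∀ a, |pot a z| ≤ M) {L : ℕ} (a : Bool) (r : ℕ) {C : ℕ → Set (CovSpace b c)}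
    (hC : ∀ n, C n ∈ cells b c L) {l : Filter ℕ} (hl : l ≤ atTop) {δ : ℝ} (hδ : 0 < δ)
    (hCδ : ∀ᶠ n in l, δ ≤ moment Q a 0 (C n)) :
    AsympClose l (fun n => empMoment (w n) a r (C n) / empMoment (w n) a 0 (C n))
      fun n => moment Q a r (C n) / moment Q a 0 (C n) := by
  have ha := armProb_pos hq0 hq1 a
  refine (((hw.asympClose hM a r hC).mono hl).div ((hw.asympClose hM a 0 hC).mono hl)
    (mul_pos ha hδ) ?_).congr' .rfl ?_
  · filter_upwards [hCδ] with n hn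
    gcongr
  · exact .of_forall fun n => mul_div_mul_left _ _ ha.ne'

/-- Along any sequence of admissible trees, the empirical variance is eventually finite and is
asymptotically equal to the population variance. -/
theorem empVar_sub_V (hw : MomentConsistent Q q w) (hq0 : 0 < q) (hq1 : q < 1)
    (hM : ∀ᵐ z ∂Q, ∀ a, |pot a z| ≤ M) {ν δ : ℝ} (hν : 0 < ν) (hδ : 0 < δ) {L : ℕ}
    (T : ℕ → StratTree b c L) (hT : ∀ n, Admissible Q ν δ (T n)) :
    (∀ᶠ n in atTop, empVar (w n) (T n) = (empVarReal (w n) (T n) : EReal)) ∧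
      Tendsto (fun n => empVarReal (w n) (T n) - V Q (T n)) atTop (𝓝 0) := by
  have hcell : ∀ k n, (T n).stratum k ∈ cells b c L := fun k n => (T n).stratum_mem_cells k
  have hpos : ∀ k a n, (∃ x, (T n).S x = k) → δ ≤ moment Q a 0 ((T n).stratum k) :=
    fun k a n h => by
      rw [moment_zero]
      exact ((hT n).2 k h).le
  refine ⟨?_, ?_⟩
  · have h1 : ∀ k a, ∀ᶠ n in atTop, (∃ x, (T n).S x = k) →
        0 < empMoment (w n) a 0 ((T n).stratum k) := fun k a => by
      have := ((hw.asympClose hM a 0 (hcell k)).mono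
        (inf_le_left : atTop ⊓ 𝓟 {n | ∃ x, (T n).S x = k} ≤ atTop)).eventually_pos
        (mul_pos (armProb_pos hq0 hq1 a) hδ) ?_
      · exact eventually_inf_principal.1 this
      · refine eventually_inf_principal.2 (.of_forall fun n hn => ?_)
        have := armProb_pos hq0 hq1 a
        gcongr
        exact hpos k a n hn
    filter_upwards [eventually_all.2 fun k => eventually_all.2 (h1 k)] with n hn
    rw [empVar_eq, if_pos fun k hk a => hn k a hk]
  · have huniv : ∀ a, AsympClose atTop
        (fun n => empMoment (w n) a 1 Set.univ / empMoment (w n) a 0 Set.univ)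
        fun _ => moment Q a 1 Set.univ / moment Q a 0 Set.univ := fun a =>
      hw.asympClose_ratio hq0 hq1 hM a 1 (C := fun _ => Set.univ) (fun _ => univ_mem_cells 0)
        le_rfl one_pos (.of_forall fun n => by simp [moment_zero])
    simp only [V_eq hM, empVarReal, ← Finset.sum_sub_distrib]
    rw [show (0 : ℝ) = ∑ _k : Fin (2 ^ L), (0 : ℝ) by simp]
    refine tendsto_finsetSum _ fun k _ => ?_
    -- Whether label k is in use may change with n. The indices are split accordingly: δ bounds the
    -- mass on one part, and both contributions vanish on the other.
    have hsup : atTop ≤ (atTop ⊓ 𝓟 {n | ∃ x, (T n).S x = k}) ⊔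
        (atTop ⊓ 𝓟 {n | ∃ x, (T n).S x = k}ᶜ) := by
      rw [← inf_sup_left, sup_principal, Set.union_compl_self, principal_univ, inf_top_eq]
    refine (Tendsto.sup ?_ ?_).mono_left hsup
    · have hl : atTop ⊓ 𝓟 {n | ∃ x, (T n).S x = k} ≤ atTop := inf_le_left
      have hδk : ∀ a, ∀ᶠ n in atTop ⊓ 𝓟 {n | ∃ x, (T n).S x = k},
          δ ≤ moment Q a 0 ((T n).stratum k) := fun a =>
        eventually_inf_principal.2 (.of_forall fun n hn => hpos k a n hn)
      refine (cellTerm_asympClose ?_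
        (fun a => hw.asympClose_ratio hq0 hq1 hM a 1 (hcell k) hl hδ (hδk a))
        (fun a => hw.asympClose_ratio hq0 hq1 hM a 2 (hcell k) hl hδ (hδk a))
        (((huniv true).sub (huniv false)).mono hl) hν fun n => (hT n).1 k).tendsto
      -- The weight m(k)/n adds the two arms, whose limits are q and 1 - q times the mass of the
      -- stratum.
      refine (((hw.asympClose hM true 0 (hcell k)).add
        (hw.asympClose hM false 0 (hcell k))).mono hl).congr' .rfl (.of_forall fun n => ?_)
      simp only [moment_zero, armProb]
      simp only [if_true, Bool.false_eq_true, if_false]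
      ring
    · refine tendsto_const_nhds.congr' ?_
      refine eventually_inf_principal.2 (.of_forall fun n hn => ?_)
      have hempty : (T n).stratum k = ∅ :=
        Set.eq_empty_iff_forall_notMem.2 fun x hx => hn ⟨x, hx⟩
      simp [hempty, cellTerm, moment, empMoment]

end MomentConsistent

/-! ### The population variance of admissible trees -/

section Population

variable {Q : Measure (PotUnit b c)} {L : ℕ}

theorem cellVar_nonneg [IsProbabilityMeasure Q] {M : ℝ} (hM : ∀ᵐ z ∂Q, ∀ a, |pot a z| ≤ M)
    (T : StratTree b c L) (a : Bool) (k : Fin (2 ^ L)) : 0 ≤ cellVar Q T a k := by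
  rcases eq_or_ne (Q {z | T.S z.2.2 = k}) 0 with h | h
  · simp [cellVar, cellMean, cond_eq_zero_of_meas_eq_zero h]
  · have := cond_isProbabilityMeasure h
    have hL : MemLp (pot a) 2 (ProbabilityTheory.cond Q {z | T.S z.2.2 = k}) :=
      MemLp.of_bound (measurable_pot a).aestronglyMeasurable M
        (cond_absolutelyContinuous.ae_le (by filter_upwards [hM] with z hz using hz a))
    have h1 := variance_eq_sub hL
    have h2 := variance_nonneg (pot a) (ProbabilityTheory.cond Q {z | T.S z.2.2 = k})
    rw [h1] at h2
    exact h2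

theorem V_nonneg [IsProbabilityMeasure Q] {M : ℝ} (hM : ∀ᵐ z ∂Q, ∀ a, |pot a z| ≤ M)
    {ν δ : ℝ} (hν : 0 < ν) {T : StratTree b c L} (hT : Admissible Q ν δ T) : 0 ≤ V Q T := by
  refine Finset.sum_nonneg fun k _ => mul_nonneg measureReal_nonneg ?_
  have h1 := hT.1 k
  exact add_nonneg (sq_nonneg _) (add_nonneg
    (div_nonneg (cellVar_nonneg hM T _ k) (by linarith [h1.2]))
    (div_nonneg (cellVar_nonneg hM T _ k) (by linarith [h1.1])))

/-- Nonzero terms come from nonempty strata, and these correspond under T.S x ↦ T'.S x. The numbers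
of labels may differ, so only nonzero terms are matched. -/
theorem V_eq_of_sameTree {L' : ℕ} {T : StratTree b c L} {T' : StratTree b c L'}
    (h : SameTree T T') : V Q T = V Q T' := by
  have hne : ∀ {L : ℕ} (T : StratTree b c L) (k : Fin (2 ^ L)),
      Q.real {z | T.S z.2.2 = k} * ((cellMean Q T k (fun z => pot true z - pot false z)
        - ∫ z, (pot true z - pot false z) ∂Q) ^ 2
        + (cellVar Q T false k / (1 - T.π k) + cellVar Q T true k / T.π k)) ≠ 0 →
      ∃ x, T.S x = k := by
    intro L T k hk
    by_contra hx
    push Not at hx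
    exact hk (by simp [hx])
  have hset : ∀ x, {z : PotUnit b c | T.S z.2.2 = T.S x} = {z | T'.S z.2.2 = T'.S x} := fun x => by
    ext z
    exact h.1 _ _
  refine Finset.sum_bij_ne_zero (fun k _ hk => T'.S (hne T k hk).choose) (fun _ _ _ => Finset.mem_univ _)
    ?_ ?_ ?_
  · intro k _ hk k' _ hk' he
    rw [← (hne T k hk).choose_spec, ← (hne T k' hk').choose_spec]
    exact (h.1 _ _).2 he
  · intro k' _ hk'
    obtain ⟨x, rfl⟩ := hne T' k' hk'
    have hk : _ ≠ (0 : ℝ) := hk'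
    simp only [cellMean, cellVar, ← hset x, ← h.2 x] at hk
    refine ⟨T.S x, Finset.mem_univ _, hk, ?_⟩
    exact (h.1 _ _).1 (hne T (T.S x) hk).choose_spec
  · intro k _ hk
    have hx := (hne T k hk).choose_spec
    set x := (hne T k hk).choose
    simp only [cellMean, cellVar, ← hset x, ← h.2 x, hx]

end Population

/-! ### Convergence of the cross-validated tree -/

section Convergence

variable {Q : Measure (PotUnit b c)} [IsProbabilityMeasure Q] {q M ν δ : ℝ}

theorem bddBelow_V (hM : ∀ᵐ z ∂Q, ∀ a, |pot a z| ≤ M) (hν : 0 < ν) {L : ℕ}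
    {𝒯 : Set (StratTree b c L)} (hadm : ∀ T ∈ 𝒯, Admissible Q ν δ T) : BddBelow (V Q '' 𝒯) := by
  refine ⟨0, ?_⟩
  rintro _ ⟨T, hT, rfl⟩
  exact V_nonneg hM hν (hadm T hT)

/-- The population variance of empirical minimizers tends to its infimum. -/
theorem MomentConsistent.tendsto_V_minimizer {N : ℕ → ℕ} {w : ∀ n, Fin (N n) → Obs b c}
    (hw : MomentConsistent Q q w) (hq0 : 0 < q) (hq1 : q < 1)
    (hM : ∀ᵐ z ∂Q, ∀ a, |pot a z| ≤ M) (hν : 0 < ν) (hδ : 0 < δ) {L : ℕ}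
    {𝒯 : Set (StratTree b c L)} (hadm : ∀ T ∈ 𝒯, Admissible Q ν δ T) {T : ℕ → StratTree b c L}
    (hT : ∀ n, T n ∈ 𝒯) (hmin : ∀ n, ∀ T' ∈ 𝒯, empVar (w n) (T n) ≤ empVar (w n) T') :
    Tendsto (fun n => V Q (T n)) atTop (𝓝 (Vstar Q 𝒯)) := by
  -- From below, the infimum itself is the bound. From above, the minimizer is compared with one
  -- fixed tree T' with V(T') < a.
  refine tendsto_order.2 ⟨fun a ha => .of_forall fun n => ha.trans_le
    (csInf_le (bddBelow_V hM hν hadm) ⟨_, hT n, rfl⟩), fun a ha => ?_⟩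
  obtain ⟨_, ⟨T', hT', rfl⟩, hlt⟩ := exists_lt_of_csInf_lt
    (⟨_, T 0, hT 0, rfl⟩ : (V Q '' 𝒯).Nonempty) ha
  obtain ⟨h1, h2⟩ := hw.empVar_sub_V hq0 hq1 hM hν hδ T fun n => hadm _ (hT n)
  obtain ⟨h3, h4⟩ := hw.empVar_sub_V hq0 hq1 hM hν hδ (fun _ => T') fun _ => hadm _ hT'
  have h5 := (h4.sub h2).eventually_lt_const (show (0 : ℝ) - 0 < a - V Q T' by linarith)
  filter_upwards [h1, h3, h5] with n hn1 hn3 hn5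
  have hle := hmin n T' hT'
  rw [hn1, hn3, EReal.coe_le_coe_iff] at hle
  linarith

variable {est : TreeRule b c} {Lbar : ℕ}

theorem cvDepth_spec {n : ℕ} (w : Fin (n + n) → Obs b c) :
    cvDepth est Lbar w ≤ Lbar ∧
      ∀ L' ≤ Lbar, cvCriterion est w (cvDepth est Lbar w) ≤ cvCriterion est w L' := by
  obtain ⟨L, hL, hmin⟩ := Finset.exists_min_image (Finset.Iic Lbar) (cvCriterion est w) ⟨0, by simp⟩
  exact Nat.sInf_mem (s := {L | L ≤ Lbar ∧ ∀ L' ≤ Lbar, cvCriterion est w L ≤ cvCriterion est w L'})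
    ⟨L, by simpa using hL, fun L' hL' => hmin L' (by simpa using hL')⟩

/-- A deterministic statement about one fixed data sequence; all probability is in the consistency
and minimality hypotheses. -/
theorem tendsto_V_cvTree {w : ∀ n, Fin (n + n) → Obs b c} (hw : MomentConsistent Q q w)
    (hw1 : MomentConsistent Q q fun n => fold1 (w n))
    (hw2 : MomentConsistent Q q fun n => fold2 (w n)) (hq0 : 0 < q) (hq1 : q < 1)
    (hM : ∀ᵐ z ∂Q, ∀ a, |pot a z| ≤ M) (hν : 0 < ν) (hδ : 0 < δ)
    {𝒯 : (L : ℕ) → Set (StratTree b c L)}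
    (hadm : ∀ L ≤ Lbar, ∀ T ∈ 𝒯 L, Admissible Q ν δ T)
    (hnest : ∀ L ≤ Lbar, ∀ T ∈ 𝒯 L, ∃ T' ∈ 𝒯 Lbar, SameTree T T')
    (hmem : ∀ L ≤ Lbar, ∀ n w, est L n w ∈ 𝒯 L)
    (hmin : ∀ L ≤ Lbar, ∀ n, ∀ T ∈ 𝒯 L, empVar (w n) (est L (n + n) (w n)) ≤ empVar (w n) T)
    (hmin1 : ∀ L ≤ Lbar, ∀ n, ∀ T ∈ 𝒯 L,
      empVar (fold1 (w n)) (est L n (fold1 (w n))) ≤ empVar (fold1 (w n)) T)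
    (hmin2 : ∀ L ≤ Lbar, ∀ n, ∀ T ∈ 𝒯 L,
      empVar (fold2 (w n)) (est L n (fold2 (w n))) ≤ empVar (fold2 (w n)) T) :
    Tendsto (fun n => |V Q (cvTree est Lbar (w n)).2 - Vstar Q (𝒯 Lbar)|) atTop (𝓝 0) := by
  have hfull : ∀ L ≤ Lbar, Tendsto (fun n => V Q (est L (n + n) (w n))) atTop
      (𝓝 (Vstar Q (𝒯 L))) := fun L hL =>
    hw.tendsto_V_minimizer hq0 hq1 hM hν hδ (hadm L hL) (fun n => hmem L hL _ _) (hmin L hL)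
  have hcrit : ∀ L ≤ Lbar, ∃ e : ℕ → ℝ, (∀ᶠ n in atTop, cvCriterion est (w n) L = (e n : EReal)) ∧
      Tendsto e atTop (𝓝 (Vstar Q (𝒯 L))) := fun L hL => by
    have g1 := hw1.tendsto_V_minimizer hq0 hq1 hM hν hδ (hadm L hL)
      (fun n => hmem L hL _ (fold1 (w n))) (hmin1 L hL)
    have g2 := hw2.tendsto_V_minimizer hq0 hq1 hM hν hδ (hadm L hL)
      (fun n => hmem L hL _ (fold2 (w n))) (hmin2 L hL)
    -- The tree fitted on one half is evaluated on the other. Its V tends to V*_L by minimality on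
    -- its own half, and Ṽ - V → 0 on the other half because consistency holds along any sequence of
    -- trees.
    obtain ⟨h1, h2⟩ := hw1.empVar_sub_V hq0 hq1 hM hν hδ (fun n => est L n (fold2 (w n)))
      fun n => hadm L hL _ (hmem L hL _ _)
    obtain ⟨h3, h4⟩ := hw2.empVar_sub_V hq0 hq1 hM hν hδ (fun n => est L n (fold1 (w n)))
      fun n => hadm L hL _ (hmem L hL _ _)
    refine ⟨fun n => (empVarReal (fold1 (w n)) (est L n (fold2 (w n)))
      + empVarReal (fold2 (w n)) (est L n (fold1 (w n)))) / 2, ?_, ?_⟩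
    · filter_upwards [h1, h3] with n hn1 hn3
      rw [cvCriterion, hn1, hn3, ← EReal.coe_add, EReal.coe_div]
      rfl
    · have := ((h2.add g2).add (h4.add g1)).div_const 2
      simp only [sub_add_cancel, zero_add, add_self_div_two] at this
      exact this
  have hV : ∀ L ≤ Lbar, Vstar Q (𝒯 Lbar) ≤ Vstar Q (𝒯 L) := fun L hL => by
    -- The estimate from the empty sample shows that the class is nonempty.
    refine le_csInf ⟨_, _, hmem L hL 0 Fin.elim0, rfl⟩ ?_
    rintro _ ⟨T, hT, rfl⟩
    obtain ⟨T', hT', hs⟩ := hnest L hL T hT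
    rw [V_eq_of_sameTree hs]
    exact csInf_le (bddBelow_V hM hν (hadm Lbar le_rfl)) ⟨T', hT', rfl⟩
  choose! e he1 he2 using hcrit
  refine Metric.tendsto_nhds.2 fun ε hε => ?_
  -- The upper bound costs three errors of ε/4: from V(T̂) to V*_L̂, from there to the criterion at
  -- L̂, and from the criterion at Lbar to V*_Lbar. The lower bound costs one, since V*_L̂ is at
  -- least V*_Lbar.
  have hev : ∀ᶠ n in atTop, ∀ L ∈ Set.Iic Lbar, cvCriterion est (w n) L = (e L n : EReal) ∧
      |e L n - Vstar Q (𝒯 L)| < ε / 4 ∧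
      |V Q (est L (n + n) (w n)) - Vstar Q (𝒯 L)| < ε / 4 := by
    refine (eventually_all_finite (Set.finite_Iic Lbar)).2 fun L hL => ?_
    exact (he1 L hL).and ((Metric.tendsto_nhds.1 (he2 L hL) _ (by positivity)).and
      (Metric.tendsto_nhds.1 (hfull L hL) _ (by positivity)))
  filter_upwards [hev] with n hn
  obtain ⟨hle, hopt⟩ := cvDepth_spec (est := est) (Lbar := Lbar) (w n)
  obtain ⟨a1, a2, a3⟩ := hn _ hle
  obtain ⟨b1, b2, -⟩ := hn Lbar (Set.mem_Iic.2 le_rfl)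
  have hopt := hopt Lbar le_rfl
  rw [a1, b1, EReal.coe_le_coe_iff] at hopt
  have hle := hV _ hle
  rw [Real.dist_eq, sub_zero, abs_abs, abs_lt]
  rw [abs_lt] at a2 a3 b2
  change -ε < V Q (est (cvDepth est Lbar (w n)) (n + n) (w n)) - _ ∧
    V Q (est (cvDepth est Lbar (w n)) (n + n) (w n)) - _ < ε
  constructor <;> linarith [a2.1, a2.2, a3.1, a3.2, b2.1, b2.2]

end Convergence

/-! ### Consistency of the pilot data and its halves -/

section Pilot

variable {Ω : Type*} [MeasurableSpace Ω] {P : Measure Ω} [IsProbabilityMeasure P]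
  {Q : Measure (PotUnit b c)} {q M : ℝ} {Z : ℕ → Ω → PotUnit b c} {A : ℕ → Ω → Bool}

theorem SimpleRandomAssignment.ae_momentConsistent (h : SimpleRandomAssignment P Q q Z A)
    (hq0 : 0 ≤ q) (hM : ∀ᵐ z ∂Q, ∀ a, |pot a z| ≤ M) :
    ∀ᵐ ω ∂P, MomentConsistent Q q (fun n => pilot Z A (n + n) ω) ∧
      MomentConsistent Q q (fun n => fold1 (pilot Z A (n + n) ω)) ∧
      MomentConsistent Q q (fun n => fold2 (pilot Z A (n + n) ω)) := by
  filter_upwards [ae_all_iff.2 fun L => ae_all_iff.2 fun a => ae_all_iff.2 fun r =>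
    h.ae_uniform_empMoment hq0 hM L a r] with ω hω
  have hdouble : Tendsto (fun n : ℕ => n + n) atTop atTop :=
    tendsto_atTop_mono (fun n => Nat.le_add_right n n) tendsto_id
  have hfull : MomentConsistent Q q (fun n => pilot Z A (n + n) ω) := by
    intro L a r C hC
    refine Metric.tendsto_nhds.2 fun ε hε => ?_
    filter_upwards [hdouble.eventually (hω L a r (ε / 2) (by positivity))] with n hn
    rw [Real.dist_eq, sub_zero]
    exact (hn _ (hC n)).trans_lt (by linarith)
  -- The first half of the sample of size n + n is by definition the pilot sample of size n.
  have hhalf : MomentConsistent Q q (fun n => fold1 (pilot Z A (n + n) ω)) := by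
    intro L a r C hC
    refine Metric.tendsto_nhds.2 fun ε hε => ?_
    filter_upwards [hω L a r (ε / 2) (by positivity)] with n hn
    rw [Real.dist_eq, sub_zero]
    exact (hn _ (hC n)).trans_lt (by linarith)
  refine ⟨hfull, hhalf, fun L a r C hC => ?_⟩
  have := ((hfull L a r C hC).const_mul 2).sub (hhalf L a r C hC)
  simp only [mul_zero, sub_zero] at this
  refine this.congr fun n => ?_
  rw [empMoment_fold2]
  ring

/-- Minimality is assumed almost surely for the law of a sample of each size. Both halves have the
law of a sample of size n, the second because it consists of the distinct units n + j. -/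
theorem SimpleRandomAssignment.ae_pilot_folds (h : SimpleRandomAssignment P Q q Z A)
    {p : (n : ℕ) → (Fin n → Obs b c) → Prop} (hp : ∀ n, ∀ᵐ w ∂(P.map (pilot Z A n)), p n w) :
    ∀ᵐ ω ∂P, ∀ n, p (n + n) (pilot Z A (n + n) ω) ∧ p n (fold1 (pilot Z A (n + n) ω)) ∧
      p n (fold2 (pilot Z A (n + n) ω)) := by
  refine ae_all_iff.2 fun n => ?_
  have h2 : ∀ᵐ ω ∂P, p n (fold2 (pilot Z A (n + n) ω)) := by
    have hinj : Function.Injective fun j : Fin n => n + (j : ℕ) := fun i j hij =>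
      Fin.ext (Nat.add_left_cancel hij)
    have := hp n
    rw [← h.map_subsample hinj] at this
    exact ae_of_ae_map (measurable_pi_iff.2 fun j : Fin n =>
      h.measurable_obs (n + j)).aemeasurable this
  filter_upwards [ae_of_ae_map (h.measurable_pilot (n + n)).aemeasurable (hp (n + n)),
    ae_of_ae_map (h.measurable_pilot n).aemeasurable (hp n), h2] with ω h1 h2 h3
  exact ⟨h1, h2, h3⟩

end Pilot

/-! ### Measurability of the cross-validated tree -/

section Measurability

theorem measurable_empMoment {n : ℕ} (a : Bool) (r : ℕ) {C : Set (CovSpace b c)}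
    (hC : MeasurableSet C) : Measurable fun w : Fin n → Obs b c => empMoment w a r C := by
  have ha : MeasurableSet {o : Obs b c | o.2.1 = a ∧ o.2.2 ∈ C} :=
    ((measurable_fst.comp measurable_snd) (measurableSet_singleton a)).inter
      (measurable_covariate_obs hC)
  exact (Finset.measurable_sum _ fun j _ =>
    ((measurable_fst.pow_const r).indicator ha).comp (measurable_pi_apply j)).div_const _

theorem measurable_cellTerm {α : Type*} [MeasurableSpace α] {p D : α → ℝ} {x y : α → Bool → ℝ}
    {t : ℝ} (hp : Measurable p) (hx : ∀ a, Measurable fun i => x i a)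
    (hy : ∀ a, Measurable fun i => y i a) (hD : Measurable D) :
    Measurable fun i => cellTerm (p i) (x i) (y i) (D i) t :=
  hp.mul (((((hx true).sub (hx false)).sub hD).pow_const 2).add
    ((((hy false).sub ((hx false).pow_const 2)).div_const _).add
      (((hy true).sub ((hx true).pow_const 2)).div_const _)))

theorem measurable_empVar {n L : ℕ} (T : StratTree b c L) :
    Measurable fun w : Fin n → Obs b c => empVar w T := by
  classical
  have hm : ∀ a r k, Measurable fun w : Fin n → Obs b c => empMoment w a r (T.stratum k) :=
    fun a r k => measurable_empMoment a r (T.measurableSet_stratum k)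
  have hu : ∀ a r, Measurable fun w : Fin n → Obs b c => empMoment w a r Set.univ :=
    fun a r => measurable_empMoment a r .univ
  simp only [empVar_eq]
  refine Measurable.ite ?_ ?_ measurable_const
  · have : {w : Fin n → Obs b c | ∀ k, (∃ x, T.S x = k) → ∀ a, 0 < empMoment w a 0 (T.stratum k)} =
        ⋂ k, ⋂ (_ : ∃ x, T.S x = k), ⋂ a, {w | 0 < empMoment w a 0 (T.stratum k)} := by
      ext w
      simp only [Set.mem_ofPred_eq, Set.mem_iInter]
    rw [this]
    exact .iInter fun k => .iInter fun _ => .iInter fun a =>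
      measurableSet_lt measurable_const (hm a 0 k)
  · refine measurable_coe_real_ereal.comp ?_
    exact Finset.measurable_sum _ fun k _ => measurable_cellTerm
      ((hm true 0 k).add (hm false 0 k)) (fun a => (hm a 1 k).div (hm a 0 k))
      (fun a => (hm a 2 k).div (hm a 0 k))
      (((hu true 1).div (hu true 0)).sub ((hu false 1).div (hu false 0)))

/-- The domain splits into countably many measurable level sets of g, on each of which the second
argument is constant; no joint measurability of f is needed. -/
theorem measurable_comp_countable {α β γ : Type*} [MeasurableSpace α] [MeasurableSpace γ]
    {f : α → β → γ} {g : α → β} {s : Set β} (hs : s.Countable) (hg : ∀ x, g x ∈ s)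
    (hgm : Measurable[_, ⊤] g) (hf : ∀ y, Measurable fun x => f x y) :
    Measurable fun x => f x (g x) := by
  intro B hB
  have : (fun x => f x (g x)) ⁻¹' B = ⋃ y ∈ s, g ⁻¹' {y} ∩ (fun x => f x y) ⁻¹' B := by
    ext x
    simp only [Set.mem_preimage, Set.mem_iUnion, Set.mem_inter_iff, Set.mem_singleton_iff]
    exact ⟨fun h => ⟨g x, hg x, rfl, h⟩, fun ⟨y, _, h1, h2⟩ => h1 ▸ h2⟩
  rw [this]
  exact .biUnion hs fun y _ => (hgm (MeasurableSpace.measurableSet_top)).inter (hf y hB)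

variable {est : TreeRule b c} {Lbar : ℕ} {𝒯 : (L : ℕ) → Set (StratTree b c L)}

theorem measurable_cvCriterion {L : ℕ} (hcount : (𝒯 L).Countable)
    (hmem : ∀ n w, est L n w ∈ 𝒯 L) (hest : ∀ n, Measurable[inferInstance, ⊤] (est L n)) (n : ℕ) :
    Measurable fun w : Fin (n + n) → Obs b c => cvCriterion est w L := by
  have h1 : Measurable (fold1 : (Fin (n + n) → Obs b c) → _) :=
    measurable_pi_iff.2 fun j => measurable_pi_apply _
  have h2 : Measurable (fold2 : (Fin (n + n) → Obs b c) → _) :=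
    measurable_pi_iff.2 fun j => measurable_pi_apply _
  have e1 : Measurable fun w : Fin (n + n) → Obs b c => empVar (fold1 w) (est L n (fold2 w)) :=
    measurable_comp_countable (f := fun w T => empVar (fold1 w) T) hcount (fun w => hmem _ _)
      ((hest n).comp h2) fun T => (measurable_empVar T).comp h1
  have e2 : Measurable fun w : Fin (n + n) → Obs b c => empVar (fold2 w) (est L n (fold1 w)) :=
    measurable_comp_countable (f := fun w T => empVar (fold2 w) T) hcount (fun w => hmem _ _)
      ((hest n).comp h1) fun T => (measurable_empVar T).comp h2
  simp only [cvCriterion, EReal.div_eq_inv_mul]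
  exact (e1.add e2).const_mul _

theorem measurableSet_cvDepth_eq {n : ℕ}
    (h : ∀ L ≤ Lbar, Measurable fun w : Fin (n + n) → Obs b c => cvCriterion est w L) (L : ℕ) :
    MeasurableSet {w : Fin (n + n) → Obs b c | cvDepth est Lbar w = L} := by
  have hmin : ∀ L, MeasurableSet {w : Fin (n + n) → Obs b c |
      L ≤ Lbar ∧ ∀ L' ≤ Lbar, cvCriterion est w L ≤ cvCriterion est w L'} := fun L => by
    by_cases hL : L ≤ Lbar
    · have : {w : Fin (n + n) → Obs b c |
          L ≤ Lbar ∧ ∀ L' ≤ Lbar, cvCriterion est w L ≤ cvCriterion est w L'} =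
          ⋂ L', ⋂ (_ : L' ≤ Lbar), {w | cvCriterion est w L ≤ cvCriterion est w L'} := by
        ext w
        simp [hL]
      rw [this]
      exact .iInter fun L' => .iInter fun hL' => measurableSet_le (h L hL) (h L' hL')
    · simp [hL]
  -- The smallest minimizer is L exactly when L is a minimizer and no smaller depth is.
  have : {w : Fin (n + n) → Obs b c | cvDepth est Lbar w = L} =
      {w | L ≤ Lbar ∧ ∀ L' ≤ Lbar, cvCriterion est w L ≤ cvCriterion est w L'} ∩
      ⋂ L', ⋂ (_ : L' < L),
        {w | L' ≤ Lbar ∧ ∀ L'' ≤ Lbar, cvCriterion est w L' ≤ cvCriterion est w L''}ᶜ := by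
    ext w
    simp only [Set.mem_inter_iff, Set.mem_iInter, Set.mem_compl_iff]
    constructor
    · rintro rfl
      exact ⟨cvDepth_spec w, fun L' hL' => Nat.notMem_of_lt_sInf hL'⟩
    · rintro ⟨h1, h2⟩
      refine le_antisymm (Nat.sInf_le h1) ?_
      by_contra hlt
      exact h2 _ (not_le.1 hlt) (cvDepth_spec w)
  rw [this]
  exact (hmin L).inter (.iInter fun L' => .iInter fun _ => (hmin L').compl)

theorem measurable_cvTree (hcount : ∀ L ≤ Lbar, (𝒯 L).Countable)
    (hmem : ∀ L ≤ Lbar, ∀ n w, est L n w ∈ 𝒯 L)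
    (hest : ∀ L ≤ Lbar, ∀ n, Measurable[inferInstance, ⊤] (est L n)) (n : ℕ) :
    Measurable[inferInstance, ⊤] fun w : Fin (n + n) → Obs b c => cvTree est Lbar w := by
  intro B _
  have : (fun w : Fin (n + n) → Obs b c => cvTree est Lbar w) ⁻¹' B =
      ⋃ L, ⋃ (_ : L ≤ Lbar), {w | cvDepth est Lbar w = L} ∩ est L (n + n) ⁻¹' {T | ⟨L, T⟩ ∈ B} := by
    ext w
    simp only [Set.mem_preimage, Set.mem_iUnion, Set.mem_inter_iff]
    constructor
    · intro hw
      exact ⟨_, (cvDepth_spec w).1, rfl, hw⟩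
    · rintro ⟨_, _, rfl, hw⟩
      exact hw
  rw [this]
  refine .iUnion fun L => .iUnion fun hL => (measurableSet_cvDepth_eq (fun L' hL' =>
    measurable_cvCriterion (hcount L' hL') (hmem L' hL') (hest L' hL') n) L).inter ?_
  exact hest L hL (n + n) MeasurableSpace.measurableSet_top

end Measurability

end StratTrees

end

/-! ### The proposition: measurability and almost sure convergence combined -/

theorem proposition3p2 {d : ℕ} (b c : Fin d → ℝ)
    (Q : Measure (StratTrees.PotUnit b c)) [IsProbabilityMeasure Q]
    (hQ : StratTrees.RegularDesign Q)
    (ν δ : ℝ) (hν : 0 < ν) (hδ : 0 < δ)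
    -- the classes of stratification trees of depth `L ≤ Lbar`, increasing in `L`
    (Lbar : ℕ) (𝒯 : (L : ℕ) → Set (StratTrees.StratTree b c L))
    (hadm : ∀ L ≤ Lbar, ∀ T ∈ 𝒯 L, StratTrees.Admissible Q ν δ T)
    (hcount : ∀ L ≤ Lbar, (𝒯 L).Countable)
    (hnest : ∀ L L', L ≤ L' → L' ≤ Lbar → ∀ T ∈ 𝒯 L, ∃ T' ∈ 𝒯 L', StratTrees.SameTree T T')
    -- the pilot experiment
    {Ω : Type*} [MeasurableSpace Ω] (P : Measure Ω) [IsProbabilityMeasure P]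
    (q : ℝ) (hq0 : 0 < q) (hq1 : q < 1)
    (Z : ℕ → Ω → StratTrees.PotUnit b c) (A : ℕ → Ω → Bool)
    (hsra : StratTrees.SimpleRandomAssignment P Q q Z A)
    -- the empirical minimizers `T̂_L`, as functions of the data
    (est : StratTrees.TreeRule b c)
    (hest_mem : ∀ L ≤ Lbar, ∀ n w, est L n w ∈ 𝒯 L)
    (hest_min : ∀ L ≤ Lbar, ∀ n, ∀ᵐ w ∂(P.map (StratTrees.pilot Z A n)),
      ∀ T ∈ 𝒯 L, StratTrees.empVar w (est L n w) ≤ StratTrees.empVar w T) :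
    -- the cross-validated tree is a measurable function of the pilot data if the `T̂_L` are;
    -- the Borel sets of the countable metric spaces `𝒯 L` are all their subsets
    ((∀ L ≤ Lbar, ∀ n, Measurable[inferInstance, ⊤] (est L n)) →
      ∀ n, Measurable[inferInstance, ⊤]
        (fun w : Fin (n + n) → StratTrees.Obs b c => StratTrees.cvTree est Lbar w)) ∧
    ∀ᵐ ω ∂P, Tendsto
      (fun n : ℕ =>
        |StratTrees.V Q (StratTrees.cvTree est Lbar (StratTrees.pilot Z A (n + n) ω)).2
          - StratTrees.Vstar Q (𝒯 Lbar)|)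
      atTop (𝓝 0) := by
  obtain ⟨M, hM⟩ := hQ.bounded
  have hM' : ∀ᵐ z ∂Q, ∀ a, |StratTrees.pot a z| ≤ M := by
    filter_upwards [hM] with z hz a
    exact abs_le.2 (hz a)
  refine ⟨fun hmeas => StratTrees.measurable_cvTree hcount hest_mem hmeas, ?_⟩
  -- One null set for all depths, so that minimality can be transferred to the full sample and both
  -- halves at once.
  have hmin : ∀ n, ∀ᵐ w ∂(P.map (StratTrees.pilot Z A n)), ∀ L ≤ Lbar, ∀ T ∈ 𝒯 L,
      StratTrees.empVar w (est L n w) ≤ StratTrees.empVar w T := fun n =>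
    ae_all_iff.2 fun L => by
      by_cases hL : L ≤ Lbar
      · filter_upwards [hest_min L hL n] with w hw _
        exact hw
      · simp [hL]
  filter_upwards [hsra.ae_momentConsistent hq0.le hM', hsra.ae_pilot_folds hmin] with ω hω hω'
  exact StratTrees.tendsto_V_cvTree hω.1 hω.2.1 hω.2.2 hq0 hq1 hM' hν hδ hadm
    (fun L hL => hnest L Lbar hL le_rfl) hest_mem (fun L hL n => (hω' n).1 L hL)
    (fun L hL n => (hω' n).2.1 L hL) (fun L hL n => (hω' n).2.2 L hL)
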